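/- Work over $\mathbb{C}$. Let $A$ be a finite-dimensional commutative local Frobenius algebra and let $B\subseteq A$ be a (unital) subalgebra which is itself a Frobenius algebra and such that $A$ is free of rank two as a $B$-module. (A finite-dimensional algebra $R$ is Frobenius if it admits a linear form $\lambda$ for which $(x,y)\mapsto\lambda(xy)$ is nondegenerate.) Let $\mathscr{G}$ be the $\mathbb{C}$-linear $2$-category with one object, identified with the category of finite-dimensional $A$-modules, whose $1$-morphisms are the endofunctors of this category lying in the additive closure (direct summands of finite direct sums) of the identity functor and the functor $A\otimes_BA\otimes_A{}_-$, and whose $2$-morphisms are all natural transformations of functors. Let $D=\mathbb{C}[x]/(x^2)$, and let $\mathscr{C}_D$ be the $\mathbb{C}$-linear $2$-category with one object, identified with the category of finite-dimensional $D$-modules, whose $1$-morphisms are the endofunctors in the additive closure of the identity functor and the functor $D\otimes_{\mathbb{C}}D\otimes_D{}_-$, and whose $2$-morphisms are all natural transformations. A $2$-ideal of a $\mathbb{C}$-linear $2$-category is a family of subspaces of the spaces of $2$-morphisms which is stable under vertical and horizontal composition with arbitrary $2$-morphisms on both sides; the quotient by a $2$-ideal has the same objects and $1$-morphisms, and the quotient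 spaces as spaces of $2$-morphisms. A $\mathbb{C}$-linear biequivalence is a pseudofunctor which is $\mathbb{C}$-linear on $2$-morphisms, an equivalence on categories of $1$-morphisms, and surjective on objects up to equivalence. Then, among the $2$-ideals of $\mathscr{G}$ which do not contain the identity $2$-morphism of any nonzero $1$-morphism, there is exactly one, $\mathscr{J}$, that is maximal with respect to inclusion. Moreover, the quotient $\mathscr{G}/\mathscr{J}$ is $\mathbb{C}$-linearly biequivalent to $\mathscr{C}_D$. -/

import Mathlib

open CategoryTheory CategoryTheory.Limits CategoryTheory.Bicategory

universe w v u w₁ v₁ u₁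

/-! ## Linear 2-categories -/

/-- A bicategory whose categories of 1-morphisms are `k`-linear is a `k`-linear bicategory if
horizontal composition is `k`-linear in 2-morphisms. -/
class LinearBicategory (k : Type*) [CommRing k] (𝓑 : Type u) [Bicategory.{w, v} 𝓑]
    [∀ a b : 𝓑, Preadditive (a ⟶ b)] [∀ a b : 𝓑, Linear k (a ⟶ b)] : Prop where
  whiskerLeft_add : ∀ {a b c : 𝓑} (f : a ⟶ b) {g h : b ⟶ c} (α β : g ⟶ h),
    f ◁ (α + β) = f ◁ α + f ◁ β
  add_whiskerRight : ∀ {a b c : 𝓑} {f g : a ⟶ b} (α β : f ⟶ g) (h : b ⟶ c),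
    (α + β) ▷ h = α ▷ h + β ▷ h
  whiskerLeft_smul : ∀ {a b c : 𝓑} (f : a ⟶ b) {g h : b ⟶ c} (r : k) (α : g ⟶ h),
    f ◁ (r • α) = r • f ◁ α
  smul_whiskerRight : ∀ {a b c : 𝓑} {f g : a ⟶ b} (r : k) (α : f ⟶ g) (h : b ⟶ c),
    (r • α) ▷ h = r • α ▷ h

/-- A (two-sided) 2-ideal of a `k`-linear bicategory: a choice of a `k`-subspace of every space of
2-morphisms, stable under vertical composition with arbitrary 2-morphisms and under horizontal
composition with arbitrary 1-morphisms, on both sides. (By the interchange law it is then stable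
under horizontal composition with arbitrary 2-morphisms.) -/
@[ext]
structure TwoIdeal (k : Type*) [CommRing k] (𝓑 : Type u) [Bicategory.{w, v} 𝓑]
    [∀ a b : 𝓑, Preadditive (a ⟶ b)] [∀ a b : 𝓑, Linear k (a ⟶ b)] where
  carrier : ∀ {a b : 𝓑} (f g : a ⟶ b), Submodule k (f ⟶ g)
  comp_mem_right : ∀ {a b : 𝓑} {f g h : a ⟶ b} {α : f ⟶ g} (β : g ⟶ h),
    α ∈ carrier f g → α ≫ β ∈ carrier f h
  comp_mem_left : ∀ {a b : 𝓑} {f g h : a ⟶ b} (α : f ⟶ g) {β : g ⟶ h},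
    β ∈ carrier g h → α ≫ β ∈ carrier f h
  whiskerLeft_mem : ∀ {a b c : 𝓑} (f : a ⟶ b) {g h : b ⟶ c} {α : g ⟶ h},
    α ∈ carrier g h → f ◁ α ∈ carrier (f ≫ g) (f ≫ h)
  whiskerRight_mem : ∀ {a b c : 𝓑} {f g : a ⟶ b} {α : f ⟶ g} (h : b ⟶ c),
    α ∈ carrier f g → α ▷ h ∈ carrier (f ≫ h) (g ≫ h)

namespace TwoIdeal

variable {k : Type*} [CommRing k] {𝓑 : Type u} [Bicategory.{w, v} 𝓑]
    [∀ a b : 𝓑, Preadditive (a ⟶ b)] [∀ a b : 𝓑, Linear k (a ⟶ b)]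

/-- 2-ideals are ordered by inclusion. -/
instance : PartialOrder (TwoIdeal k 𝓑) where
  le I J := ∀ ⦃a b : 𝓑⦄ (f g : a ⟶ b), I.carrier f g ≤ J.carrier f g
  le_refl _ _ _ _ _ := le_rfl
  le_trans _ _ _ h h' _ _ f g := (h f g).trans (h' f g)
  le_antisymm I J h h' := by
    ext a b f g : 5
    exact le_antisymm (h f g) (h' f g)

/-- The 2-ideal `I` contains no identity 2-morphism of a nonzero 1-morphism. -/
def ContainsNoIdentity (I : TwoIdeal k 𝓑) : Prop :=
  ∀ ⦃a b : 𝓑⦄ (f : a ⟶ b), ¬ IsZero f → 𝟙 f ∉ I.carrier f f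

variable (I : TwoIdeal k 𝓑)

/-- The quotient of a `k`-linear bicategory by a 2-ideal: it has the same objects and the same
1-morphisms, and its spaces of 2-morphisms are the quotients by the subspaces in the ideal. -/
structure Quotient (I : TwoIdeal k 𝓑) : Type u where
  obj : 𝓑

namespace Quotient

variable {I}

/-- 1-morphisms of the quotient: those of the given bicategory. -/
structure Hom (a b : I.Quotient) : Type v where
  hom : a.obj ⟶ b.obj

instance : CategoryStruct.{v} I.Quotient where
  Hom := Hom
  id a := ⟨𝟙 a.obj⟩
  comp f g := ⟨f.hom ≫ g.hom⟩

/-- 2-morphisms of the quotient. -/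
def Hom₂ {a b : I.Quotient} (f g : a ⟶ b) : Type w :=
  (Hom.hom f ⟶ Hom.hom g) ⧸ I.carrier (Hom.hom f) (Hom.hom g)

instance {a b : I.Quotient} (f g : a ⟶ b) : AddCommGroup (Hom₂ f g) :=
  inferInstanceAs (AddCommGroup ((Hom.hom f ⟶ Hom.hom g) ⧸ I.carrier (Hom.hom f) (Hom.hom g)))

instance {a b : I.Quotient} (f g : a ⟶ b) : Module k (Hom₂ f g) :=
  inferInstanceAs (Module k ((Hom.hom f ⟶ Hom.hom g) ⧸ I.carrier (Hom.hom f) (Hom.hom g)))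

/-- The quotient map on 2-morphisms. -/
def cls {a b : I.Quotient} {f g : a ⟶ b} : (Hom.hom f ⟶ Hom.hom g) →ₗ[k] Hom₂ f g :=
  (I.carrier (Hom.hom f) (Hom.hom g)).mkQ

lemma cls_surjective {a b : I.Quotient} {f g : a ⟶ b} :
    Function.Surjective (cls : (Hom.hom f ⟶ Hom.hom g) →ₗ[k] Hom₂ f g) :=
  Submodule.mkQ_surjective _

lemma cls_eq_iff {a b : I.Quotient} {f g : a ⟶ b} (α β : Hom.hom f ⟶ Hom.hom g) :
    (cls α : Hom₂ f g) = cls β ↔ α - β ∈ I.carrier (Hom.hom f) (Hom.hom g) :=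
  Submodule.Quotient.eq _

/-- Vertical composition of classes. -/
def vcomp {a b : I.Quotient} {f g h : a ⟶ b} (x : Hom₂ f g) (y : Hom₂ g h) : Hom₂ f h :=
  Quotient.liftOn₂' x y (fun α β => (cls (α ≫ β) : Hom₂ f h)) (by
    intro α β α' β' h₁ h₂
    rw [Submodule.quotientRel_def] at h₁ h₂
    rw [cls_eq_iff]
    have : α ≫ β - α' ≫ β' = (α - α') ≫ β + α' ≫ (β - β') := by
      simp [Preadditive.sub_comp, Preadditive.comp_sub]
    rw [this]
    exact add_mem (I.comp_mem_right _ h₁) (I.comp_mem_left _ h₂))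

@[simp]
lemma vcomp_cls {a b : I.Quotient} {f g h : a ⟶ b} (α : Hom.hom f ⟶ Hom.hom g)
    (β : Hom.hom g ⟶ Hom.hom h) :
    vcomp (cls α : Hom₂ f g) (cls β : Hom₂ g h) = cls (α ≫ β) := rfl

instance homCategory (a b : I.Quotient) : Category.{w} (a ⟶ b) where
  Hom f g := Hom₂ f g
  id f := (cls (𝟙 (Hom.hom f)) : Hom₂ f f)
  comp x y := vcomp x y
  id_comp x := by obtain ⟨α, rfl⟩ := cls_surjective x; simp
  comp_id x := by obtain ⟨α, rfl⟩ := cls_surjective x; simp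
  assoc x y z := by
    obtain ⟨α, rfl⟩ := cls_surjective x
    obtain ⟨β, rfl⟩ := cls_surjective y
    obtain ⟨γ, rfl⟩ := cls_surjective z
    simp

/-- The class of a 2-morphism of `𝓑`, as a 2-morphism of the quotient. -/
def proj {a b : I.Quotient} {f g : a ⟶ b} (α : Hom.hom f ⟶ Hom.hom g) : f ⟶ g :=
  (cls α : Hom₂ f g)

lemma proj_surjective {a b : I.Quotient} {f g : a ⟶ b} (x : f ⟶ g) :
    ∃ α : Hom.hom f ⟶ Hom.hom g, proj α = x := cls_surjective x

lemma proj_eq_iff {a b : I.Quotient} {f g : a ⟶ b} (α β : Hom.hom f ⟶ Hom.hom g) :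
    (proj α : f ⟶ g) = proj β ↔ α - β ∈ I.carrier (Hom.hom f) (Hom.hom g) :=
  cls_eq_iff α β

lemma proj_comp {a b : I.Quotient} {f g h : a ⟶ b} (α : Hom.hom f ⟶ Hom.hom g)
    (β : Hom.hom g ⟶ Hom.hom h) : (proj (α ≫ β) : f ⟶ h) = (proj α : f ⟶ g) ≫ (proj β : g ⟶ h) := rfl

lemma proj_id {a b : I.Quotient} (f : a ⟶ b) : (proj (𝟙 (Hom.hom f)) : f ⟶ f) = 𝟙 f := rfl

instance (a b : I.Quotient) : Preadditive (a ⟶ b) where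
  homGroup f g := inferInstanceAs (AddCommGroup (Hom₂ f g))
  add_comp f g h x y z := by
    obtain ⟨α, rfl⟩ := cls_surjective x
    obtain ⟨β, rfl⟩ := cls_surjective y
    obtain ⟨γ, rfl⟩ := cls_surjective z
    change vcomp (cls α + cls β : Hom₂ f g) (cls γ : Hom₂ g h) =
      vcomp (cls α : Hom₂ f g) (cls γ : Hom₂ g h) + vcomp (cls β : Hom₂ f g) (cls γ : Hom₂ g h)
    rw [← map_add]
    simp only [vcomp_cls]
    rw [← map_add, Preadditive.add_comp]
  comp_add f g h x y z := by
    obtain ⟨α, rfl⟩ := cls_surjective x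
    obtain ⟨β, rfl⟩ := cls_surjective y
    obtain ⟨γ, rfl⟩ := cls_surjective z
    change vcomp (cls α : Hom₂ f g) (cls β + cls γ : Hom₂ g h) =
      vcomp (cls α : Hom₂ f g) (cls β : Hom₂ g h) + vcomp (cls α : Hom₂ f g) (cls γ : Hom₂ g h)
    rw [← map_add]
    simp only [vcomp_cls]
    rw [← map_add, Preadditive.comp_add]

instance (a b : I.Quotient) : Linear k (a ⟶ b) where
  homModule f g := inferInstanceAs (Module k (Hom₂ f g))
  smul_comp f g h r x y := by
    obtain ⟨α, rfl⟩ := cls_surjective x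
    obtain ⟨β, rfl⟩ := cls_surjective y
    change vcomp (r • cls α : Hom₂ f g) (cls β : Hom₂ g h) =
      r • vcomp (cls α : Hom₂ f g) (cls β : Hom₂ g h)
    rw [← map_smul]
    simp only [vcomp_cls]
    rw [← map_smul, Linear.smul_comp]
  comp_smul f g h x r y := by
    obtain ⟨α, rfl⟩ := cls_surjective x
    obtain ⟨β, rfl⟩ := cls_surjective y
    change vcomp (cls α : Hom₂ f g) (r • cls β : Hom₂ g h) =
      r • vcomp (cls α : Hom₂ f g) (cls β : Hom₂ g h)
    rw [← map_smul]
    simp only [vcomp_cls]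
    rw [← map_smul, Linear.comp_smul]

lemma proj_add {a b : I.Quotient} {f g : a ⟶ b} (α β : Hom.hom f ⟶ Hom.hom g) :
    (proj (α + β) : f ⟶ g) = proj α + proj β := rfl

lemma proj_smul {a b : I.Quotient} {f g : a ⟶ b} (r : k) (α : Hom.hom f ⟶ Hom.hom g) :
    (proj (r • α) : f ⟶ g) = r • proj α := rfl

/-- The class of an invertible 2-morphism. -/
@[simps]
def projIso {a b : I.Quotient} {f g : a ⟶ b} (e : Hom.hom f ≅ Hom.hom g) : f ≅ g where
  hom := proj e.hom
  inv := proj e.inv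
  hom_inv_id := by rw [← proj_comp, e.hom_inv_id, proj_id]
  inv_hom_id := by rw [← proj_comp, e.inv_hom_id, proj_id]

variable [LinearBicategory k 𝓑]

/-- Left whiskering of classes. -/
def wLeft {a b c : I.Quotient} (f : a ⟶ b) {g h : b ⟶ c} (x : g ⟶ h) : (f ≫ g) ⟶ (f ≫ h) :=
  Quotient.liftOn' x (fun α => (proj (Hom.hom f ◁ α) : (f ≫ g) ⟶ (f ≫ h))) (by
    intro α β h₁
    rw [Submodule.quotientRel_def] at h₁
    rw [proj_eq_iff]
    have : Hom.hom f ◁ α = Hom.hom f ◁ (α - β) + Hom.hom f ◁ β := by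
      rw [← LinearBicategory.whiskerLeft_add k, sub_add_cancel]
    rw [this, add_sub_cancel_right]
    exact I.whiskerLeft_mem _ h₁)

/-- Right whiskering of classes. -/
def wRight {a b c : I.Quotient} {f g : a ⟶ b} (x : f ⟶ g) (h : b ⟶ c) : (f ≫ h) ⟶ (g ≫ h) :=
  Quotient.liftOn' x (fun α => (proj (α ▷ Hom.hom h) : (f ≫ h) ⟶ (g ≫ h))) (by
    intro α β h₁
    rw [Submodule.quotientRel_def] at h₁
    rw [proj_eq_iff]
    have : α ▷ Hom.hom h = (α - β) ▷ Hom.hom h + β ▷ Hom.hom h := by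
      rw [← LinearBicategory.add_whiskerRight k, sub_add_cancel]
    rw [this, add_sub_cancel_right]
    exact I.whiskerRight_mem _ h₁)

lemma wLeft_proj {a b c : I.Quotient} (f : a ⟶ b) {g h : b ⟶ c} (α : Hom.hom g ⟶ Hom.hom h) :
    wLeft f (proj α : g ⟶ h) = proj (Hom.hom f ◁ α) := rfl

lemma wRight_proj {a b c : I.Quotient} {f g : a ⟶ b} (α : Hom.hom f ⟶ Hom.hom g) (h : b ⟶ c) :
    wRight (proj α : f ⟶ g) h = proj (α ▷ Hom.hom h) := rfl

instance : Bicategory.{w, v} I.Quotient where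
  homCategory := homCategory
  whiskerLeft f _ _ x := wLeft f x
  whiskerRight x h := wRight x h
  associator f g h := projIso (α_ (Hom.hom f) (Hom.hom g) (Hom.hom h))
  leftUnitor f := projIso (λ_ (Hom.hom f))
  rightUnitor f := projIso (ρ_ (Hom.hom f))
  whiskerLeft_id f g := congrArg proj (Bicategory.whiskerLeft_id (Hom.hom f) (Hom.hom g))
  whiskerLeft_comp f g h i x y := by
    obtain ⟨α, rfl⟩ := proj_surjective x
    obtain ⟨β, rfl⟩ := proj_surjective y
    exact congrArg proj (Bicategory.whiskerLeft_comp (Hom.hom f) α β)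
  id_whiskerLeft x := by
    obtain ⟨α, rfl⟩ := proj_surjective x
    exact congrArg proj (Bicategory.id_whiskerLeft α)
  comp_whiskerLeft f g _ _ x := by
    obtain ⟨α, rfl⟩ := proj_surjective x
    exact congrArg proj (Bicategory.comp_whiskerLeft (Hom.hom f) (Hom.hom g) α)
  id_whiskerRight f g := congrArg proj (Bicategory.id_whiskerRight (Hom.hom f) (Hom.hom g))
  comp_whiskerRight x y i := by
    obtain ⟨α, rfl⟩ := proj_surjective x
    obtain ⟨β, rfl⟩ := proj_surjective y
    exact congrArg proj (Bicategory.comp_whiskerRight α β (Hom.hom i))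
  whiskerRight_id x := by
    obtain ⟨α, rfl⟩ := proj_surjective x
    exact congrArg proj (Bicategory.whiskerRight_id α)
  whiskerRight_comp x g h := by
    obtain ⟨α, rfl⟩ := proj_surjective x
    exact congrArg proj (Bicategory.whiskerRight_comp α (Hom.hom g) (Hom.hom h))
  whisker_assoc f _ _ x h := by
    obtain ⟨α, rfl⟩ := proj_surjective x
    exact congrArg proj (Bicategory.whisker_assoc (Hom.hom f) α (Hom.hom h))
  whisker_exchange x y := by
    obtain ⟨α, rfl⟩ := proj_surjective x
    obtain ⟨β, rfl⟩ := proj_surjective y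
    exact congrArg proj (Bicategory.whisker_exchange α β)
  pentagon f g h i :=
    congrArg proj (Bicategory.pentagon (Hom.hom f) (Hom.hom g) (Hom.hom h) (Hom.hom i))
  triangle f g := congrArg proj (Bicategory.triangle (Hom.hom f) (Hom.hom g))

instance : LinearBicategory k I.Quotient where
  whiskerLeft_add f _ _ x y := by
    obtain ⟨α, rfl⟩ := proj_surjective x
    obtain ⟨β, rfl⟩ := proj_surjective y
    exact congrArg proj (LinearBicategory.whiskerLeft_add k (Hom.hom f) α β)
  add_whiskerRight x y h := by
    obtain ⟨α, rfl⟩ := proj_surjective x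
    obtain ⟨β, rfl⟩ := proj_surjective y
    exact congrArg proj (LinearBicategory.add_whiskerRight k α β (Hom.hom h))
  whiskerLeft_smul f _ _ r x := by
    obtain ⟨α, rfl⟩ := proj_surjective x
    exact congrArg proj (LinearBicategory.whiskerLeft_smul (Hom.hom f) r α)
  smul_whiskerRight r x h := by
    obtain ⟨α, rfl⟩ := proj_surjective x
    exact congrArg proj (LinearBicategory.smul_whiskerRight r α (Hom.hom h))

end Quotient

end TwoIdeal

/-- A pseudofunctor between `k`-linear bicategories is a (`k`-linear) biequivalence if it is `k`-linear
on 2-morphisms, is an equivalence on all categories of 1-morphisms, and is surjective on objects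
up to equivalence. -/
structure IsLinearBiequivalence (k : Type*) [CommRing k]
    {𝓑 : Type u} [Bicategory.{w, v} 𝓑]
    [∀ a b : 𝓑, Preadditive (a ⟶ b)] [∀ a b : 𝓑, Linear k (a ⟶ b)]
    {𝓒 : Type u₁} [Bicategory.{w₁, v₁} 𝓒]
    [∀ a b : 𝓒, Preadditive (a ⟶ b)] [∀ a b : 𝓒, Linear k (a ⟶ b)]
    (Φ : Pseudofunctor 𝓑 𝓒) : Prop where
  map₂_add : ∀ {a b : 𝓑} {f g : a ⟶ b} (α β : f ⟶ g), Φ.map₂ (α + β) = Φ.map₂ α + Φ.map₂ β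
  map₂_smul : ∀ {a b : 𝓑} {f g : a ⟶ b} (r : k) (α : f ⟶ g), Φ.map₂ (r • α) = r • Φ.map₂ α
  locally_equivalence : ∀ a b : 𝓑, (Φ.mapFunctor a b).IsEquivalence
  essSurj : ∀ c : 𝓒, ∃ b : 𝓑, Nonempty (Bicategory.Equivalence (Φ.obj b) c)

/-! ## Additive closures -/

/-- The additive closure of a class `P` of objects: all direct summands (retracts) of finite direct
sums `b.pt = T 0 ⊕ ⋯ ⊕ T (n - 1)` of objects from `P`, including the zero object for `n = 0`.
Here a biproduct bicone `b` exhibits `b.pt` as the direct sum of the `T i`. -/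
def additiveClosure {C : Type u} [Category.{v} C] [Preadditive C] (P : ObjectProperty C) :
    ObjectProperty C := fun X =>
  ∃ (n : ℕ) (T : Fin n → C) (b : Bicone T), (∀ i, P (T i)) ∧ Nonempty b.IsBilimit ∧
    Nonempty (Retract X b.pt)

section additiveClosure

variable {C : Type u} [Category.{v} C] [Preadditive C] {P : ObjectProperty C}

lemma additiveClosure.exists_sum {X : C} (h : additiveClosure P X) :
    ∃ (n : ℕ) (T : Fin n → C) (p : ∀ i, X ⟶ T i) (q : ∀ i, T i ⟶ X), (∀ i, P (T i)) ∧
      ∑ i, p i ≫ q i = 𝟙 X := by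
  obtain ⟨n, T, b, hT, ⟨hb⟩, ⟨r⟩⟩ := h
  refine ⟨n, T, fun i => r.i ≫ b.π i, fun i => b.ι i ≫ r.r, hT, ?_⟩
  have := IsBilimit.total hb
  calc ∑ i, (r.i ≫ b.π i) ≫ b.ι i ≫ r.r = r.i ≫ (∑ i, b.π i ≫ b.ι i) ≫ r.r := by
        simp [Preadditive.sum_comp, Preadditive.comp_sum]
    _ = 𝟙 X := by rw [this]; simp

lemma additiveClosure_of_sum [HasFiniteBiproducts C] {X : C} {ι : Type*} [Fintype ι]
    (T : ι → C) (p : ∀ i, X ⟶ T i) (q : ∀ i, T i ⟶ X) (hT : ∀ i, P (T i))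
    (h : ∑ i, p i ≫ q i = 𝟙 X) : additiveClosure P X := by
  let e := Fintype.equivFin ι
  let b := biproduct.bicone (fun i => T (e.symm i))
  refine ⟨Fintype.card ι, fun i => T (e.symm i), b, fun i => hT _, ⟨biproduct.isBilimit _⟩, ⟨?_⟩⟩
  refine ⟨biproduct.lift (fun i => p (e.symm i)), biproduct.desc (fun i => q (e.symm i)), ?_⟩
  rw [biproduct.lift_desc, ← h]
  exact e.symm.sum_comp (fun i => p i ≫ q i)

lemma additiveClosure_of_mem [HasFiniteBiproducts C] {X : C} (h : P X) : additiveClosure P X :=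
  additiveClosure_of_sum (ι := Unit) (fun _ => X) (fun _ => 𝟙 X) (fun _ => 𝟙 X) (fun _ => h)
    (by simp)

end additiveClosure

/-! ## Tensoring with the bimodule `A ⊗_B A` -/

section TensorFunctor

open TensorProduct

variable (B : Type w) (A : Type u) [CommRing B] [CommRing A] [Algebra B A]

section unbundled

variable {M N P : Type*} [AddCommGroup M] [Module A M] [AddCommGroup N] [Module A N]
  [AddCommGroup P] [Module A P]

/-- The map `A ⊗_B A ⊗_A f`, for `f` a homomorphism of `A`-modules. -/
noncomputable def bimodTensorMap (f : M →ₗ[A] N) :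
    A ⊗[B] (A ⊗[A] M) →ₗ[A] A ⊗[B] (A ⊗[A] N) :=
  ((f.lTensor A).restrictScalars B).baseChange A

@[simp]
lemma bimodTensorMap_tmul (f : M →ₗ[A] N) (a a' : A) (m : M) :
    bimodTensorMap B A f (a ⊗ₜ[B] (a' ⊗ₜ[A] m)) = a ⊗ₜ[B] (a' ⊗ₜ[A] f m) := rfl

variable {B A} in
lemma bimodTensor_ext {f g : A ⊗[B] (A ⊗[A] M) →ₗ[A] P}
    (h : ∀ a a' m, f (a ⊗ₜ[B] (a' ⊗ₜ[A] m)) = g (a ⊗ₜ[B] (a' ⊗ₜ[A] m))) : f = g := by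
  ext x
  induction x with
  | zero => simp
  | add x y hx hy => rw [map_add, map_add, hx, hy]
  | tmul a y =>
    induction y with
    | zero => simp
    | add x y hx hy => rw [TensorProduct.tmul_add, map_add, map_add, hx, hy]
    | tmul a' m => exact h a a' m

lemma bimodTensorMap_id : bimodTensorMap B A (LinearMap.id : M →ₗ[A] M) = LinearMap.id :=
  bimodTensor_ext fun _ _ _ => rfl

lemma bimodTensorMap_comp (g : N →ₗ[A] P) (f : M →ₗ[A] N) :
    bimodTensorMap B A (g ∘ₗ f) = bimodTensorMap B A g ∘ₗ bimodTensorMap B A f :=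
  bimodTensor_ext fun _ _ _ => rfl

lemma bimodTensorMap_add (f g : M →ₗ[A] N) :
    bimodTensorMap B A (f + g) = bimodTensorMap B A f + bimodTensorMap B A g :=
  bimodTensor_ext fun _ _ _ => by simp [TensorProduct.tmul_add]

lemma bimodTensorMap_smul (c : B) {f g : M →ₗ[A] N} (h : ∀ m, f m = algebraMap B A c • g m)
    (x : A ⊗[B] (A ⊗[A] M)) :
    bimodTensorMap B A f x = algebraMap B A c • bimodTensorMap B A g x := by
  suffices H : bimodTensorMap B A f = algebraMap B A c • bimodTensorMap B A g from
    LinearMap.congr_fun H x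
  refine bimodTensor_ext fun a a' m => ?_
  simp only [bimodTensorMap_tmul, LinearMap.smul_apply, h, TensorProduct.tmul_smul]
  rw [algebraMap_smul, algebraMap_smul, TensorProduct.tmul_smul]

/-- The map `a ⊗ x ↦ a ⊗ 1 ⊗ b ⊗ x`. -/
noncomputable def bimodTensorSplit (b : A) :
    A ⊗[B] (A ⊗[A] M) →ₗ[A] A ⊗[B] (A ⊗[A] (A ⊗[B] (A ⊗[A] M))) :=
  ((TensorProduct.mk A A (A ⊗[B] (A ⊗[A] M)) 1).restrictScalars B ∘ₗ
    TensorProduct.mk B A (A ⊗[A] M) b).baseChange A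

@[simp]
lemma bimodTensorSplit_tmul (b a : A) (x : A ⊗[A] M) :
    bimodTensorSplit B A b (a ⊗ₜ[B] x) = a ⊗ₜ[B] (1 ⊗ₜ[A] (b ⊗ₜ[B] x)) := rfl

/-- The map `a ⊗ a′ ⊗ b ⊗ x ↦ a ⊗ φ (a′ b) x`. -/
noncomputable def bimodTensorMerge (φ : A →ₗ[B] B) :
    A ⊗[B] (A ⊗[A] (A ⊗[B] (A ⊗[A] M))) →ₗ[A] A ⊗[B] (A ⊗[A] M) :=
  ((TensorProduct.lid B (A ⊗[A] M)).toLinearMap ∘ₗ φ.rTensor (A ⊗[A] M) ∘ₗ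
    (TensorProduct.lid A (A ⊗[B] (A ⊗[A] M))).toLinearMap.restrictScalars B).baseChange A

@[simp]
lemma bimodTensorMerge_tmul (φ : A →ₗ[B] B) (a a' b : A) (x : A ⊗[A] M) :
    bimodTensorMerge B A φ (a ⊗ₜ[B] (a' ⊗ₜ[A] (b ⊗ₜ[B] x))) =
      a ⊗ₜ[B] (φ (a' * b) • x) := by
  simp [bimodTensorMerge, TensorProduct.smul_tmul']

lemma bimodTensorSplit_naturality (b : A) (f : M →ₗ[A] N) :
    bimodTensorMap B A (bimodTensorMap B A f) ∘ₗ bimodTensorSplit B A b =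
      bimodTensorSplit B A b ∘ₗ bimodTensorMap B A f :=
  bimodTensor_ext fun _ _ _ => rfl

variable {B A} in
lemma bimodTensor_ext₂ {f g : A ⊗[B] (A ⊗[A] (A ⊗[B] (A ⊗[A] M))) →ₗ[A] P}
    (h : ∀ a a' b x, f (a ⊗ₜ[B] (a' ⊗ₜ[A] (b ⊗ₜ[B] x))) =
      g (a ⊗ₜ[B] (a' ⊗ₜ[A] (b ⊗ₜ[B] x)))) : f = g := by
  refine bimodTensor_ext fun a a' m => ?_
  induction m with
  | zero => simp
  | add x y hx hy => simp only [TensorProduct.tmul_add, map_add, hx, hy]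
  | tmul b x => exact h a a' b x

lemma bimodTensorMerge_naturality (φ : A →ₗ[B] B) (f : M →ₗ[A] N) :
    bimodTensorMap B A f ∘ₗ bimodTensorMerge B A φ =
      bimodTensorMerge B A φ ∘ₗ bimodTensorMap B A (bimodTensorMap B A f) :=
  bimodTensor_ext₂ fun a a' b x => by
    simp only [LinearMap.comp_apply, bimodTensorMerge_tmul, bimodTensorMap_tmul]
    simp [bimodTensorMap, bimodTensorMerge_tmul]

lemma bimodTensor_sum {ι : Type*} [Fintype ι] (e : Module.Basis ι B A) :
    ∑ i, bimodTensorSplit B A (e i) ∘ₗ bimodTensorMerge B A (e.coord i) =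
      (LinearMap.id : A ⊗[B] (A ⊗[A] (A ⊗[B] (A ⊗[A] M))) →ₗ[A] _) :=
  bimodTensor_ext₂ fun a a' b x => by
    simp only [LinearMap.sum_apply, LinearMap.comp_apply, bimodTensorMerge_tmul,
      bimodTensorSplit_tmul, LinearMap.id_apply]
    have h : ∑ i, e i ⊗ₜ[B] ((e.coord i (a' * b)) • x) = (a' * b) ⊗ₜ[B] x := by
      conv_rhs => rw [← e.sum_repr (a' * b), TensorProduct.sum_tmul]
      exact Finset.sum_congr rfl fun i _ => by
        rw [Module.Basis.coord_apply, TensorProduct.smul_tmul]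
    rw [← TensorProduct.tmul_sum, ← TensorProduct.tmul_sum, h, ← smul_eq_mul,
      ← TensorProduct.smul_tmul', TensorProduct.tmul_smul, TensorProduct.smul_tmul']
    simp

end unbundled

section

instance bimodTensor_finite [Module.Finite B A] {M : Type*} [AddCommGroup M] [Module A M]
    [Module.Finite A M] : Module.Finite A (A ⊗[B] (A ⊗[A] M)) :=
  haveI : Module.Finite B (A ⊗[A] M) := Module.Finite.trans A _
  inferInstance

/-- The endofunctor `M ↦ A ⊗_B A ⊗_A M` of the category of finitely generated `A`-modules, that is,
tensoring with the `A`-`A`-bimodule `A ⊗_B A`; the outer `A`-module structure is the one on the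
leftmost factor. -/
noncomputable def bimodTensorFunctor [Module.Finite B A] :
    FGModuleCat.{max u v} A ⥤ FGModuleCat.{max u v} A where
  obj M := FGModuleCat.of A (A ⊗[B] (A ⊗[A] M))
  map f := FGModuleCat.ofHom (bimodTensorMap B A f.hom.hom)
  map_id _ := FGModuleCat.hom_ext (bimodTensorMap_id B A)
  map_comp f g := FGModuleCat.hom_ext (bimodTensorMap_comp B A g.hom.hom f.hom.hom)


variable [Module.Finite B A]

instance : (bimodTensorFunctor.{w, v} B A).Additive where
  map_add {_ _ f g} := FGModuleCat.hom_ext (bimodTensorMap_add B A f.hom.hom g.hom.hom)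

instance [Algebra ℂ B] [Algebra ℂ A] [IsScalarTower ℂ B A] :
    (bimodTensorFunctor.{w, v} B A).Linear ℂ where
  map_smul f c := FGModuleCat.hom_ext (LinearMap.ext fun x => by
    refine (bimodTensorMap_smul B A (algebraMap ℂ B c) (f := (c • f).hom.hom)
      (g := f.hom.hom) (fun m => ?_) x).trans ?_
    · rw [← IsScalarTower.algebraMap_apply]; rfl
    · rw [← IsScalarTower.algebraMap_apply]; rfl)

/-- `bimodTensorSplit` as a natural transformation. -/
noncomputable def bimodTensorFunctorSplit (b : A) :
    bimodTensorFunctor.{w, v} B A ⟶ bimodTensorFunctor.{w, v} B A ⋙ bimodTensorFunctor.{w, v} B A where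
  app _ := FGModuleCat.ofHom (bimodTensorSplit B A b)
  naturality _ _ f := FGModuleCat.hom_ext (bimodTensorSplit_naturality B A b f.hom.hom).symm

/-- `bimodTensorMerge` as a natural transformation. -/
noncomputable def bimodTensorFunctorMerge (φ : A →ₗ[B] B) :
    bimodTensorFunctor.{w, v} B A ⋙ bimodTensorFunctor.{w, v} B A ⟶ bimodTensorFunctor.{w, v} B A where
  app _ := FGModuleCat.ofHom (bimodTensorMerge B A φ)
  naturality _ _ f := FGModuleCat.hom_ext (bimodTensorMerge_naturality B A φ f.hom.hom).symm

lemma bimodTensorFunctor_sum {ι : Type*} [Fintype ι] (e : Module.Basis ι B A) :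
    ∑ i, bimodTensorFunctorMerge.{w, v} B A (e.coord i) ≫ bimodTensorFunctorSplit.{w, v} B A (e i) = 𝟙 _ := by
  ext M : 2
  rw [NatTrans.app_sum]
  let ev (X Y : FGModuleCat.{max u v} A) : (X ⟶ Y) →+ (X →ₗ[A] Y) :=
    AddMonoidHom.mk' (fun f => f.hom.hom) (fun _ _ => rfl)
  refine FGModuleCat.hom_ext ((map_sum (ev _ _) _ _).trans ?_)
  exact bimodTensor_sum B A (M := M) e

end



end TensorFunctor

section closure

variable {C : Type*} [Category C] [Preadditive C] {P : ObjectProperty (C ⥤ C)} {X Y : C ⥤ C}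

lemma additiveClosure_additive (hP : ∀ X, P X → X.Additive) (hX : additiveClosure P X) :
    X.Additive where
  map_add {M N f g} := by
    obtain ⟨n, T, p, q, hT, h⟩ := hX.exists_sum
    have key : ∀ f : M ⟶ N, X.map f = ∑ i, (p i).app M ≫ (T i).map f ≫ (q i).app N := fun f => by
      have := congrArg (fun t => X.map f ≫ NatTrans.app t N) h
      simp only [NatTrans.app_sum, NatTrans.id_app, Category.comp_id, Preadditive.comp_sum] at this
      rw [← this]
      refine Finset.sum_congr rfl fun i _ => ?_
      simp
    have hTi := fun i => hP _ (hT i)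
    rw [key, key f, key g, ← Finset.sum_add_distrib]
    refine Finset.sum_congr rfl fun i _ => ?_
    rw [(hTi i).map_add, Preadditive.add_comp, Preadditive.comp_add]

lemma additiveClosure_linear [Linear ℂ C] (hP : ∀ X, P X → X.Linear ℂ)
    (hX : additiveClosure P X) : X.Linear ℂ where
  map_smul {M N} f c := by
    obtain ⟨n, T, p, q, hT, h⟩ := hX.exists_sum
    have key : ∀ f : M ⟶ N, X.map f = ∑ i, (p i).app M ≫ (T i).map f ≫ (q i).app N := fun f => by
      have := congrArg (fun t => X.map f ≫ NatTrans.app t N) h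
      simp only [NatTrans.app_sum, NatTrans.id_app, Category.comp_id, Preadditive.comp_sum] at this
      rw [← this]
      refine Finset.sum_congr rfl fun i _ => ?_
      simp
    have hTi := fun i => hP _ (hT i)
    rw [key, key f, Finset.smul_sum]
    refine Finset.sum_congr rfl fun i _ => ?_
    rw [(hTi i).map_smul, Linear.smul_comp, Linear.comp_smul]

lemma additiveClosure_comp [HasFiniteBiproducts (C ⥤ C)] (hP : ∀ X, P X → X.Additive)
    (hPP : ∀ X Y, P X → P Y → additiveClosure P (X ⋙ Y))
    (hX : additiveClosure P X) (hY : additiveClosure P Y) : additiveClosure P (X ⋙ Y) := by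
  have hYa := additiveClosure_additive hP hY
  obtain ⟨n, T, p, q, hT, h⟩ := hX.exists_sum
  obtain ⟨m, S, p', q', hS, h'⟩ := hY.exists_sum
  choose l U r s hU hrs using fun i j => (hPP (T i) (S j) (hT i) (hS j)).exists_sum
  refine additiveClosure_of_sum (ι := Σ i : Fin n, Σ j : Fin m, Fin (l i j))
    (fun x => U x.1 x.2.1 x.2.2)
    (fun x => Functor.whiskerRight (p x.1) Y ≫ Functor.whiskerLeft (T x.1) (p' x.2.1) ≫
      r x.1 x.2.1 x.2.2)
    (fun x => s x.1 x.2.1 x.2.2 ≫ Functor.whiskerLeft (T x.1) (q' x.2.1) ≫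
      Functor.whiskerRight (q x.1) Y)
    (fun x => hU _ _ _) ?_
  simp only [Fintype.sum_sigma]
  have h1 : ∀ i j, ∑ t, (Functor.whiskerRight (p i) Y ≫ Functor.whiskerLeft (T i) (p' j) ≫
      r i j t) ≫ s i j t ≫ Functor.whiskerLeft (T i) (q' j) ≫ Functor.whiskerRight (q i) Y =
      Functor.whiskerRight (p i) Y ≫ Functor.whiskerLeft (T i) (p' j ≫ q' j) ≫
        Functor.whiskerRight (q i) Y := fun i j => by
    have := congrArg (fun t => (Functor.whiskerRight (p i) Y ≫ Functor.whiskerLeft (T i) (p' j)) ≫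
      t ≫ Functor.whiskerLeft (T i) (q' j) ≫ Functor.whiskerRight (q i) Y) (hrs i j)
    simpa [Preadditive.sum_comp, Preadditive.comp_sum] using this
  have h2 : ∀ i, ∑ j, Functor.whiskerRight (p i) Y ≫ Functor.whiskerLeft (T i) (p' j ≫ q' j) ≫
        Functor.whiskerRight (q i) Y = Functor.whiskerRight (p i ≫ q i) Y := fun i => by
    ext M
    have := congrArg (fun t => Y.map ((p i).app M) ≫ NatTrans.app t ((T i).obj M) ≫
      Y.map ((q i).app M)) h'
    simpa [NatTrans.app_sum, Preadditive.sum_comp, Preadditive.comp_sum] using this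
  simp only [h1, h2]
  ext M
  have := congrArg (fun t => Y.map (NatTrans.app t M)) h
  simpa [NatTrans.app_sum, Functor.map_sum] using this

end closure

section

variable (B : Type w) (A : Type u) [CommRing B] [CommRing A] [Algebra B A] [Module.Finite B A]

/-- The two generating endofunctors: the identity and tensoring with `A ⊗_B A`. -/
def tensorGenerators (B : Type w) (A : Type u) [CommRing B] [CommRing A] [Algebra B A]
    [Module.Finite B A] : ObjectProperty (FGModuleCat.{max u v} A ⥤ FGModuleCat.{max u v} A) :=
  fun X => X = 𝟭 _ ∨ X = bimodTensorFunctor.{w, v} B A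

variable {B A}

lemma tensorGenerators_additive {X : FGModuleCat.{max u v} A ⥤ FGModuleCat.{max u v} A}
    (hX : tensorGenerators.{w, v} B A X) : X.Additive := by
  obtain rfl | rfl := hX <;> infer_instance

lemma tensorGenerators_linear [Algebra ℂ B] [Algebra ℂ A] [IsScalarTower ℂ B A]
    {X : FGModuleCat.{max u v} A ⥤ FGModuleCat.{max u v} A}
    (hX : tensorGenerators.{w, v} B A X) : X.Linear ℂ := by
  obtain rfl | rfl := hX <;> infer_instance

lemma hasFiniteBiproducts_functor [IsNoetherianRing A] :
    HasFiniteBiproducts (FGModuleCat.{max u v} A ⥤ FGModuleCat.{max u v} A) :=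
  HasFiniteBiproducts.of_hasFiniteProducts

lemma tensorGenerators_comp [Module.Free B A] [IsNoetherianRing A]
    (X Y : FGModuleCat.{max u v} A ⥤ FGModuleCat.{max u v} A)
    (hX : tensorGenerators.{w, v} B A X) (hY : tensorGenerators.{w, v} B A Y) :
    additiveClosure (tensorGenerators.{w, v} B A) (X ⋙ Y) := by
  have := hasFiniteBiproducts_functor.{v} (A := A)
  obtain rfl | rfl := hX
  · exact additiveClosure_of_mem hY
  obtain rfl | rfl := hY
  · exact additiveClosure_of_mem (Or.inr rfl)
  exact additiveClosure_of_sum (fun _ => bimodTensorFunctor.{w, v} B A)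
    (fun i => bimodTensorFunctorMerge.{w, v} B A ((Module.Free.chooseBasis B A).coord i))
    (fun i => bimodTensorFunctorSplit.{w, v} B A (Module.Free.chooseBasis B A i))
    (fun _ => Or.inr rfl) (bimodTensorFunctor_sum B A _)

end

/-- The one-object 2-category attached to `B → A`, where `A` is finite and free over `B`: the object is
identified with the category of finitely generated `A`-modules, the 1-morphisms are the endofunctors
in the additive closure of the identity and of tensoring with `A ⊗_B A`, and the 2-morphisms are
all natural transformations. Modules are taken in `Type (max u v)`. -/
structure TensorTwoCat (B : Type w) (A : Type u) : Type v where

namespace TensorTwoCat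

/-- The category of 1-morphisms (with all natural transformations between them). -/
abbrev OneMor (B : Type w) (A : Type u) [CommRing B] [CommRing A] [Algebra B A]
    [Module.Finite B A] :=
  (additiveClosure (tensorGenerators.{w, v} B A)).FullSubcategory

lemma OneMor.comp_mem {B : Type w} {A : Type u} [CommRing B] [CommRing A] [Algebra B A]
    [Module.Finite B A] [Module.Free B A] [Algebra ℂ A] [Module.Finite ℂ A] (X Y : OneMor.{w, v} B A) :
    additiveClosure (tensorGenerators.{w, v} B A) (X.obj ⋙ Y.obj) := by
  have := IsNoetherianRing.of_finite ℂ A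
  have := hasFiniteBiproducts_functor.{v} (A := A)
  exact additiveClosure_comp (fun _ h => tensorGenerators_additive h) tensorGenerators_comp
    X.property Y.property

lemma OneMor.id_mem (B : Type w) (A : Type u) [CommRing B] [CommRing A] [Algebra B A]
    [Module.Finite B A] [Algebra ℂ A] [Module.Finite ℂ A] :
    additiveClosure (tensorGenerators.{w, v} B A) (𝟭 _) := by
  have := IsNoetherianRing.of_finite ℂ A
  have := hasFiniteBiproducts_functor.{v} (A := A)
  exact additiveClosure_of_mem (Or.inl rfl)

variable {B : Type w} {A : Type u} [CommRing B] [CommRing A] [Algebra B A]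
  [Module.Finite B A]

instance [Module.Free B A] [Algebra ℂ A] [Module.Finite ℂ A] : CategoryStruct (TensorTwoCat.{w, v, u} B A) where
  Hom _ _ := OneMor.{w, v} B A
  id _ := ⟨𝟭 _, OneMor.id_mem B A⟩
  comp X Y := ⟨X.obj ⋙ Y.obj, OneMor.comp_mem X Y⟩

variable [Module.Free B A] [Algebra ℂ A] [Module.Finite ℂ A]

instance homCategory (a b : TensorTwoCat.{w, v} B A) : Category (a ⟶ b) :=
  inferInstanceAs (Category (OneMor.{w, v} B A))

instance homPreadditive (a b : TensorTwoCat.{w, v} B A) : Preadditive (a ⟶ b) :=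
  inferInstanceAs (Preadditive (OneMor.{w, v} B A))

noncomputable instance homLinear (a b : TensorTwoCat.{w, v} B A) : Linear ℂ (a ⟶ b) :=
  inferInstanceAs (Linear ℂ (OneMor.{w, v} B A))

/-- The endofunctor underlying a 1-morphism. -/
abbrev toFunctor {a b : TensorTwoCat.{w, v} B A} (X : a ⟶ b) :
    FGModuleCat.{max u v} A ⥤ FGModuleCat.{max u v} A :=
  ObjectProperty.FullSubcategory.obj X

/-- The natural transformation underlying a 2-morphism. -/
abbrev toNatTrans {a b : TensorTwoCat.{w, v} B A} {X Y : a ⟶ b} (α : X ⟶ Y) :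
    toFunctor X ⟶ toFunctor Y :=
  InducedCategory.Hom.hom α

/-- The 2-morphism given by a natural transformation. -/
abbrev ofNatTrans {a b : TensorTwoCat.{w, v} B A} {X Y : a ⟶ b} (α : toFunctor X ⟶ toFunctor Y) :
    X ⟶ Y :=
  ObjectProperty.homMk α

/-- The invertible 2-morphism given by a natural isomorphism. -/
abbrev ofNatIso {a b : TensorTwoCat.{w, v} B A} {X Y : a ⟶ b} (e : toFunctor X ≅ toFunctor Y) :
    X ≅ Y :=
  ObjectProperty.isoMk _ e

lemma ext₂ {a b : TensorTwoCat.{w, v} B A} {X Y : a ⟶ b} {α β : X ⟶ Y}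
    (h : ∀ M, (toNatTrans α).app M = (toNatTrans β).app M) : α = β :=
  ObjectProperty.hom_ext _ (NatTrans.ext (funext h))

lemma toNatTrans_comp_app {a b : TensorTwoCat.{w, v} B A} {X Y Z : a ⟶ b} (α : X ⟶ Y) (β : Y ⟶ Z)
    (M : FGModuleCat.{max u v} A) :
    (toNatTrans (α ≫ β)).app M = (toNatTrans α).app M ≫ (toNatTrans β).app M := rfl

lemma toNatTrans_id_app {a b : TensorTwoCat.{w, v} B A} (X : a ⟶ b)
    (M : FGModuleCat.{max u v} A) :
    (toNatTrans (𝟙 X)).app M = 𝟙 _ := rfl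

/-- `f ≫ g` is the composite functor `f ⋙ g`, that is, first `f` and then `g`. -/
instance : Bicategory (TensorTwoCat.{w, v} B A) where
  homCategory := homCategory
  whiskerLeft X Y Z α := ofNatTrans (X := X ≫ Y) (Y := X ≫ Z)
    (Functor.whiskerLeft (toFunctor X) (toNatTrans α))
  whiskerRight {_ _ _ X Y} α Z := ofNatTrans (X := X ≫ Z) (Y := Y ≫ Z)
    (Functor.whiskerRight (toNatTrans α) (toFunctor Z))
  associator X Y Z := ofNatIso (X := (X ≫ Y) ≫ Z) (Y := X ≫ Y ≫ Z)
    (Functor.associator (toFunctor X) (toFunctor Y) (toFunctor Z))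
  leftUnitor X := ofNatIso (X := 𝟙 _ ≫ X) (Y := X) (Functor.leftUnitor (toFunctor X))
  rightUnitor X := ofNatIso (X := X ≫ 𝟙 _) (Y := X) (Functor.rightUnitor (toFunctor X))
  whiskerLeft_id _ _ := rfl
  whiskerLeft_comp _ _ _ _ _ _ := rfl
  id_whiskerLeft α := ext₂ fun M => by
    simp only [toNatTrans_comp_app]
    exact ((Category.id_comp _).trans (Category.comp_id _)).symm
  comp_whiskerLeft X Y _ _ α := ext₂ fun M => by
    simp only [toNatTrans_comp_app]
    exact ((Category.id_comp _).trans (Category.comp_id _)).symm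
  id_whiskerRight X Y := ext₂ fun M => (toFunctor Y).map_id _
  comp_whiskerRight α β Y := ext₂ fun M => (toFunctor Y).map_comp _ _
  whiskerRight_id α := ext₂ fun M => by
    simp only [toNatTrans_comp_app]
    exact ((Category.id_comp _).trans (Category.comp_id _)).symm
  whiskerRight_comp α Y Z := ext₂ fun M => by
    simp only [toNatTrans_comp_app]
    exact ((Category.id_comp _).trans (Category.comp_id _)).symm
  whisker_assoc X _ _ α Y := ext₂ fun M => by
    simp only [toNatTrans_comp_app]
    exact ((Category.id_comp _).trans (Category.comp_id _)).symm
  whisker_exchange α β := ext₂ fun M => ((toNatTrans β).naturality ((toNatTrans α).app M)).symm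
  pentagon X Y Z W := ext₂ fun M => by
    simp only [toNatTrans_comp_app]
    refine (congrArg (· ≫ _) ((toFunctor W).map_id _)).trans ?_
    rfl
  triangle X Y := ext₂ fun M => by
    simp only [toNatTrans_comp_app]
    refine Eq.trans ?_ ((toFunctor Y).map_id _).symm
    exact Category.id_comp _

lemma toFunctor_additive {a b : TensorTwoCat.{w, v} B A} (X : a ⟶ b) : (toFunctor X).Additive :=
  additiveClosure_additive (fun _ h => tensorGenerators_additive h)
    (ObjectProperty.FullSubcategory.property X)

lemma toFunctor_linear [Algebra ℂ B] [IsScalarTower ℂ B A]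
    {a b : TensorTwoCat.{w, v} B A} (X : a ⟶ b) : (toFunctor X).Linear ℂ :=
  additiveClosure_linear (fun _ h => tensorGenerators_linear h)
    (ObjectProperty.FullSubcategory.property X)

instance [Algebra ℂ B] [IsScalarTower ℂ B A] :
    LinearBicategory ℂ (TensorTwoCat.{w, v} B A) where
  whiskerLeft_add _ _ _ _ _ := rfl
  add_whiskerRight _ _ Y := ext₂ fun _ => (toFunctor_additive Y).map_add
  whiskerLeft_smul _ _ _ _ _ := rfl
  smul_whiskerRight _ _ Y := ext₂ fun _ => (toFunctor_linear Y).map_smul _ _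

end TensorTwoCat

/-- A finite dimensional algebra `R` over a field `k` is a Frobenius algebra if there is a linear form
`lam` on `R` for which the bilinear form `(x, y) ↦ lam (x * y)` is nondegenerate. -/
def IsFrobeniusAlgebra (k R : Type*) [Field k] [Ring R] [Algebra k R] [Module.Finite k R] : Prop :=
  ∃ lam : R →ₗ[k] k,
    (∀ x, (∀ y, lam (x * y) = 0) → x = 0) ∧ (∀ y, (∀ x, lam (x * y) = 0) → y = 0)

instance : Module.Finite ℂ (DualNumber ℂ) := inferInstanceAs (Module.Finite ℂ (ℂ × ℂ))

instance : Module.Free ℂ (DualNumber ℂ) := inferInstanceAs (Module.Free ℂ (ℂ × ℂ))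

/-- The 2-category of projective functors over the algebra `D` of dual numbers: endofunctors of the
category of finite dimensional `D`-modules in the additive closure of the identity and of tensoring
with `D ⊗_ℂ D`, with all natural transformations. -/
abbrev DualNumberTwoCat : Type u := TensorTwoCat.{0, u, 0} ℂ (DualNumber ℂ)

/-!
The idea is base change to the closed point of `Spec B`. Let `𝔪_B` be the maximal ideal of `B` and
`𝔪 = 𝔪_B A`. The fibre `D = A ⧸ 𝔪` is a two-dimensional local algebra, hence the algebra of dual
numbers (`exists_specialFibre_dualNumber`). All 1-morphisms of the 2-category of `B → A` are
`B`-linear functors, so they preserve the full subcategory of modules killed by `𝔪_B`, which is the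
category of `D`-modules, and `F = A ⊗_B A ⊗_A _` restricts to `D ⊗_ℂ D ⊗_D _`
(`SpecialFibre.tensorIso`). This gives a linear pseudofunctor to the 2-category of the dual numbers,
`SpecialFibre.restriction`. The 2-ideal `J` is its kernel, and the biequivalence is the induced
pseudofunctor on the quotient. Four facts carry the proof.

* Fullness on 2-morphisms (`SpecialFibre.exists_restrictMap_eq`). Transformations between the
  generating functors are given by elements of their values on `A`. These can be lifted from `D` to
  `A` freely, except for transformations from the identity to `F`, which are central elements of the
  bimodule `A ⊗_B A`. There the Frobenius hypothesis enters: `A` is a Frobenius extension of `B`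
  (`IsFrobeniusAlgebra.nonempty_frobeniusSystem`), so the central elements are the multiples of a
  Casimir element, over `D` as well as over `A`.
* Endomorphisms which vanish on the special fibre are nilpotent
  (`SpecialFibre.isNilpotent_of_vanishes`): by right exactness the image of such an endomorphism of
  `X` is contained in `𝔪 X`, and `𝔪` is nilpotent. In particular `J` contains no identity of a
  nonzero 1-morphism.
* Essential surjectivity on 1-morphisms (`SpecialFibre.exists_restrict_iso_of_mem`). By the previous
  two facts idempotents lift along the restriction of endomorphism rings, so direct summands lift.
* Maximality (`SpecialFibre.le_vanishingIdeal`). If a transformation `γ` between generating functors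
  does not vanish on the special fibre, contraction with suitable `B`-linear forms shows that the
  identity of `F` factors through `F γ F` (`SpecialFibre.exists_comp_eq_id`). So every 2-ideal which
  is not contained in `J` contains the identity of the nonzero 1-morphism `F`.
-/

/-! ### Kernels of linear pseudofunctors -/

section kernel

variable {k : Type*} [CommRing k] {𝓑 : Type u} [Bicategory.{w, v} 𝓑]
  [∀ a b : 𝓑, Preadditive (a ⟶ b)] [∀ a b : 𝓑, Linear k (a ⟶ b)]
  {𝓒 : Type u₁} [Bicategory.{w₁, v₁} 𝓒]
  [∀ a b : 𝓒, Preadditive (a ⟶ b)] [∀ a b : 𝓒, Linear k (a ⟶ b)] [LinearBicategory k 𝓒]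

lemma LinearBicategory.whiskerLeft_zero (k : Type*) [CommRing k] {𝓒 : Type u₁}
    [Bicategory.{w₁, v₁} 𝓒] [∀ a b : 𝓒, Preadditive (a ⟶ b)] [∀ a b : 𝓒, Linear k (a ⟶ b)]
    [LinearBicategory k 𝓒] {a b c : 𝓒} (f : a ⟶ b) (g h : b ⟶ c) :
    f ◁ (0 : g ⟶ h) = 0 := by
  simpa using LinearBicategory.whiskerLeft_smul (k := k) f 0 (0 : g ⟶ h)

lemma LinearBicategory.zero_whiskerRight (k : Type*) [CommRing k] {𝓒 : Type u₁}
    [Bicategory.{w₁, v₁} 𝓒] [∀ a b : 𝓒, Preadditive (a ⟶ b)] [∀ a b : 𝓒, Linear k (a ⟶ b)]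
    [LinearBicategory k 𝓒] {a b c : 𝓒} (f g : a ⟶ b) (h : b ⟶ c) :
    (0 : f ⟶ g) ▷ h = 0 := by
  simpa using LinearBicategory.smul_whiskerRight (k := k) 0 (0 : f ⟶ g) h

/-- The kernel of a `k`-linear pseudofunctor: the 2-ideal of all 2-morphisms it annihilates. -/
def TwoIdeal.ker (Φ : Pseudofunctor 𝓑 𝓒)
    (hadd : ∀ {a b : 𝓑} {f g : a ⟶ b} (α β : f ⟶ g), Φ.map₂ (α + β) = Φ.map₂ α + Φ.map₂ β)
    (hsmul : ∀ {a b : 𝓑} {f g : a ⟶ b} (r : k) (α : f ⟶ g), Φ.map₂ (r • α) = r • Φ.map₂ α) :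
    TwoIdeal k 𝓑 where
  carrier f g := LinearMap.ker
    ({ toFun := fun α => Φ.map₂ α
       map_add' := hadd
       map_smul' := hsmul } : (f ⟶ g) →ₗ[k] (Φ.map f ⟶ Φ.map g))
  comp_mem_right {a b f g h α} β hα := by
    have hα : Φ.map₂ α = 0 := hα
    change Φ.map₂ (α ≫ β) = 0
    rw [Φ.map₂_comp, hα, zero_comp]
  comp_mem_left {a b f g h} α β hβ := by
    have hβ : Φ.map₂ β = 0 := hβ
    change Φ.map₂ (α ≫ β) = 0
    rw [Φ.map₂_comp, hβ, comp_zero]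
  whiskerLeft_mem {a b c} f g h α hα := by
    have hα : Φ.map₂ α = 0 := hα
    change Φ.map₂ (f ◁ α) = 0
    rw [Φ.map₂_whisker_left, hα, LinearBicategory.whiskerLeft_zero k, zero_comp, comp_zero]
  whiskerRight_mem {a b c f g α} h hα := by
    have hα : Φ.map₂ α = 0 := hα
    change Φ.map₂ (α ▷ h) = 0
    rw [Φ.map₂_whisker_right, hα, LinearBicategory.zero_whiskerRight k, zero_comp, comp_zero]

variable [LinearBicategory k 𝓑]

/-- The map on classes of 2-morphisms induced by a pseudofunctor annihilating a 2-ideal. -/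
def TwoIdeal.Quotient.descMap₂ (I : TwoIdeal k 𝓑) (Φ : Pseudofunctor 𝓑 𝓒)
    (hadd : ∀ {a b : 𝓑} {f g : a ⟶ b} (α β : f ⟶ g), Φ.map₂ (α + β) = Φ.map₂ α + Φ.map₂ β)
    (hI : ∀ {a b : 𝓑} {f g : a ⟶ b} (α : f ⟶ g), α ∈ I.carrier f g → Φ.map₂ α = 0)
    {a b : I.Quotient} {f g : a ⟶ b}
    (x : f ⟶ g) : Φ.map (Hom.hom f) ⟶ Φ.map (Hom.hom g) :=
  _root_.Quotient.liftOn' x (fun α => Φ.map₂ α) (by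
    intro α β h
    rw [Submodule.quotientRel_def] at h
    have := hadd (α - β) β
    rwa [sub_add_cancel, hI _ h, zero_add] at this)

open TwoIdeal.Quotient in
/-- A pseudofunctor which is additive on 2-morphisms and annihilates a 2-ideal factors through the
quotient. -/
def TwoIdeal.Quotient.desc (I : TwoIdeal k 𝓑) (Φ : Pseudofunctor 𝓑 𝓒)
    (hadd : ∀ {a b : 𝓑} {f g : a ⟶ b} (α β : f ⟶ g), Φ.map₂ (α + β) = Φ.map₂ α + Φ.map₂ β)
    (hI : ∀ {a b : 𝓑} {f g : a ⟶ b} (α : f ⟶ g), α ∈ I.carrier f g → Φ.map₂ α = 0) :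
    Pseudofunctor I.Quotient 𝓒 where
  obj a := Φ.obj a.obj
  map f := Φ.map (Hom.hom f)
  map₂ x := descMap₂ I Φ hadd hI x
  map₂_id f := Φ.map₂_id (Hom.hom f)
  map₂_comp x y := by
    obtain ⟨α, rfl⟩ := proj_surjective x
    obtain ⟨β, rfl⟩ := proj_surjective y
    exact Φ.map₂_comp α β
  mapId a := Φ.mapId a.obj
  mapComp f g := Φ.mapComp (Hom.hom f) (Hom.hom g)
  map₂_whisker_left f _ _ x := by
    obtain ⟨α, rfl⟩ := proj_surjective x
    exact Φ.map₂_whisker_left (Hom.hom f) α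
  map₂_whisker_right x h := by
    obtain ⟨α, rfl⟩ := proj_surjective x
    exact Φ.map₂_whisker_right α (Hom.hom h)
  map₂_associator f g h := Φ.map₂_associator (Hom.hom f) (Hom.hom g) (Hom.hom h)
  map₂_left_unitor f := Φ.map₂_left_unitor (Hom.hom f)
  map₂_right_unitor f := Φ.map₂_right_unitor (Hom.hom f)

/-- A linear pseudofunctor which is full and essentially surjective on 1-morphisms and essentially
surjective on objects induces a biequivalence from the quotient by its kernel. -/
lemma isLinearBiequivalence_desc_ker (Φ : Pseudofunctor 𝓑 𝓒)
    (hadd : ∀ {a b : 𝓑} {f g : a ⟶ b} (α β : f ⟶ g), Φ.map₂ (α + β) = Φ.map₂ α + Φ.map₂ β)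
    (hsmul : ∀ {a b : 𝓑} {f g : a ⟶ b} (r : k) (α : f ⟶ g), Φ.map₂ (r • α) = r • Φ.map₂ α)
    (hfull : ∀ {a b : 𝓑} {f g : a ⟶ b} (β : Φ.map f ⟶ Φ.map g), ∃ α : f ⟶ g, Φ.map₂ α = β)
    (hess : ∀ {a b : 𝓑} (g : Φ.obj a ⟶ Φ.obj b), ∃ f : a ⟶ b, Nonempty (Φ.map f ≅ g))
    (hobj : ∀ c : 𝓒, ∃ b : 𝓑, Nonempty (Bicategory.Equivalence (Φ.obj b) c)) :
    IsLinearBiequivalence k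
      (TwoIdeal.Quotient.desc (TwoIdeal.ker (k := k) Φ hadd hsmul) Φ hadd (fun _ h => h)) where
  map₂_add x y := by
    obtain ⟨α, rfl⟩ := TwoIdeal.Quotient.proj_surjective x
    obtain ⟨β, rfl⟩ := TwoIdeal.Quotient.proj_surjective y
    exact hadd α β
  map₂_smul r x := by
    obtain ⟨α, rfl⟩ := TwoIdeal.Quotient.proj_surjective x
    exact hsmul r α
  locally_equivalence a b :=
    { faithful :=
        ⟨fun {f g} x y h => by
          obtain ⟨α, rfl⟩ := TwoIdeal.Quotient.proj_surjective x
          obtain ⟨β, rfl⟩ := TwoIdeal.Quotient.proj_surjective y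
          rw [TwoIdeal.Quotient.proj_eq_iff]
          have h : Φ.map₂ α = Φ.map₂ β := h
          have h' := hadd (α - β) β
          rw [sub_add_cancel, h] at h'
          exact right_eq_add.mp h'⟩
      full :=
        ⟨fun {f g} β => by
          obtain ⟨α, hα⟩ := hfull β
          exact ⟨TwoIdeal.Quotient.proj α, hα⟩⟩
      essSurj :=
        ⟨fun g => by
          obtain ⟨f, hf⟩ := hess g
          exact ⟨⟨f⟩, hf⟩⟩ }
  essSurj c := by
    obtain ⟨b, hb⟩ := hobj c
    exact ⟨⟨b⟩, hb⟩

end kernel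

/-! ### Endofunctors commuting with scalars -/

section scalars

variable {A : Type u} [CommRing A]

/-- Multiplication by a ring element, as an endomorphism of a finitely generated module. -/
def scalarEnd (a : A) (M : FGModuleCat.{v} A) : M ⟶ M :=
  FGModuleCat.ofHom (LinearMap.lsmul A M a)

/-- A linear map, as a morphism in the category of finitely generated modules. -/
def homOfLinear {M N : FGModuleCat.{v} A} (f : M →ₗ[A] N) : M ⟶ N :=
  ObjectProperty.homMk (ModuleCat.ofHom f)

/-- A linear equivalence, as an isomorphism in the category of finitely generated modules. -/
def isoOfLinearEquiv {M N : FGModuleCat.{v} A} (e : M ≃ₗ[A] N) : M ≅ N where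
  hom := ObjectProperty.homMk (ModuleCat.ofHom e.toLinearMap)
  inv := ObjectProperty.homMk (ModuleCat.ofHom e.symm.toLinearMap)
  hom_inv_id := FGModuleCat.hom_ext (LinearMap.ext e.symm_apply_apply)
  inv_hom_id := FGModuleCat.hom_ext (LinearMap.ext e.apply_symm_apply)

@[simp]
lemma scalarEnd_apply (a : A) (M : FGModuleCat.{v} A) (m : M) :
    (scalarEnd a M).hom.hom m = a • m := rfl

lemma scalarEnd_comp {M N : FGModuleCat.{v} A} (a : A) (f : M ⟶ N) :
    scalarEnd a M ≫ f = f ≫ scalarEnd a N :=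
  FGModuleCat.hom_ext (LinearMap.ext fun m => f.hom.hom.map_smul a m)

variable (B : Type w) [CommRing B] [Algebra B A]

/-- `X` is a `B`-linear functor: it sends multiplication by a scalar of `B` to multiplication by the
same scalar. -/
def CommutesWithScalars (X : FGModuleCat.{v} A ⥤ FGModuleCat.{v} A) : Prop :=
  ∀ (b : B) (M : FGModuleCat.{v} A),
    X.map (scalarEnd (algebraMap B A b) M) = scalarEnd (algebraMap B A b) (X.obj M)

variable {B}

lemma CommutesWithScalars.map_apply {X : FGModuleCat.{v} A ⥤ FGModuleCat.{v} A}
    (hX : CommutesWithScalars B X) {M N : FGModuleCat.{v} A} {f g : M ⟶ N} {b : B}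
    (h : ∀ m, f.hom.hom m = algebraMap B A b • g.hom.hom m) (x : X.obj M) :
    (X.map f).hom.hom x = algebraMap B A b • (X.map g).hom.hom x := by
  have hf : f = g ≫ scalarEnd (algebraMap B A b) N := FGModuleCat.hom_ext (LinearMap.ext h)
  rw [hf, X.map_comp, hX]
  rfl

lemma CommutesWithScalars.id : CommutesWithScalars B (𝟭 (FGModuleCat.{v} A)) := fun _ _ => rfl

lemma CommutesWithScalars.comp {X Y : FGModuleCat.{v} A ⥤ FGModuleCat.{v} A}
    (hX : CommutesWithScalars B X) (hY : CommutesWithScalars B Y) :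
    CommutesWithScalars B (X ⋙ Y) := fun b M => by
  rw [Functor.comp_map, hX, hY]
  rfl

lemma CommutesWithScalars.of_additiveClosure
    {P : ObjectProperty (FGModuleCat.{v} A ⥤ FGModuleCat.{v} A)}
    (hP : ∀ X, P X → CommutesWithScalars B X) {X : FGModuleCat.{v} A ⥤ FGModuleCat.{v} A}
    (hX : additiveClosure P X) : CommutesWithScalars B X := fun b M => by
  obtain ⟨n, T, p, q, hT, h⟩ := hX.exists_sum
  have h := congrArg (fun t => NatTrans.app t M) h
  simp only [NatTrans.app_sum, NatTrans.comp_app, NatTrans.id_app] at h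
  have h1 : X.map (scalarEnd (algebraMap B A b) M) =
      X.map (scalarEnd (algebraMap B A b) M) ≫ ∑ i, (p i).app M ≫ (q i).app M := by
    rw [h, Category.comp_id]
  rw [h1, ← Category.comp_id (scalarEnd _ (X.obj M)), ← h, Preadditive.comp_sum,
    Preadditive.comp_sum]
  refine Finset.sum_congr rfl fun i _ => ?_
  rw [NatTrans.naturality_assoc, hP _ (hT i), ← Category.assoc, ← Category.assoc,
    scalarEnd_comp]

variable [Module.Finite B A]

lemma bimodTensorFunctor_commutesWithScalars :
    CommutesWithScalars B (bimodTensorFunctor.{w, v} B A) := fun b M =>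
  FGModuleCat.hom_ext (LinearMap.ext fun x =>
    (bimodTensorMap_smul B A b (f := (scalarEnd (algebraMap B A b) M).hom.hom)
      (g := LinearMap.id) (fun _ => rfl) x).trans
        (congrArg (algebraMap B A b • ·) (LinearMap.congr_fun (bimodTensorMap_id B A) x)))

lemma tensorGenerators_commutesWithScalars {X : FGModuleCat.{max u v} A ⥤ FGModuleCat.{max u v} A}
    (hX : tensorGenerators.{w, v} B A X) : CommutesWithScalars B X := by
  obtain rfl | rfl := hX
  · exact CommutesWithScalars.id
  · exact bimodTensorFunctor_commutesWithScalars

end scalars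

/-! ### Restriction of scalars along the special fibre -/

/-- A presentation of the `ℂ`-algebra `D` as the fibre `A ⊗_B ℂ` of `B → A` over a closed point
`χ` of `B`: a surjection `A → D` which is `χ` on `B`, with kernel generated by the kernel of `χ`. -/
structure SpecialFibre (B : Type w) (A : Type u) (D : Type v) [CommRing B] [CommRing A] [CommRing D]
    [Algebra B A] [Algebra ℂ B] [Algebra ℂ A] [Algebra ℂ D] where
  /-- The closed point. -/
  χ : B →ₐ[ℂ] ℂ
  /-- The quotient map onto the fibre. -/
  π : A →ₐ[ℂ] D
  surjective : Function.Surjective π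
  π_algebraMap : ∀ b, π (algebraMap B A b) = algebraMap ℂ D (χ b)
  mem_of_π_eq_zero : ∀ a, π a = 0 → a ∈ (RingHom.ker χ).map (algebraMap B A)

namespace SpecialFibre

variable {B : Type w} {A : Type u} {D : Type v} [CommRing B] [CommRing A] [CommRing D]
    [Algebra B A] [Algebra ℂ B] [Algebra ℂ A] [Algebra ℂ D] (S : SpecialFibre B A D)

lemma finite_restrictScalars (M : FGModuleCat.{v₁} D) :
    ModuleCat.isFG A ((ModuleCat.restrictScalars S.π.toRingHom).obj M.obj) := by
  let := S.π.toRingHom.toAlgebra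
  let : Module A M := Module.compHom M S.π.toRingHom
  have : IsScalarTower A D M := ⟨fun a d m => mul_smul (S.π a) d m⟩
  have : Module.Finite A D :=
    Module.Finite.of_surjective (Algebra.linearMap A D) S.surjective
  exact Module.Finite.trans (R := A) D M

/-- Restriction of scalars from `D` to `A`. -/
noncomputable def res : FGModuleCat.{v₁} D ⥤ FGModuleCat.{v₁} A :=
  (ModuleCat.isFG A).lift ((ModuleCat.isFG D).ι ⋙ ModuleCat.restrictScalars S.π.toRingHom)
    S.finite_restrictScalars

/-- The identity of the underlying abelian groups. -/
noncomputable def toRes (M : FGModuleCat.{v₁} D) : M ≃+ S.res.obj M := AddEquiv.refl M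

@[simp]
lemma smul_toRes (M : FGModuleCat.{v₁} D) (a : A) (m : M) :
    a • S.toRes M m = S.toRes M (S.π a • m) := rfl

@[simp]
lemma res_map_toRes {M N : FGModuleCat.{v₁} D} (f : M ⟶ N) (m : M) :
    (S.res.map f).hom.hom (S.toRes M m) = S.toRes N (f.hom.hom m) := rfl

instance : S.res.Faithful where
  map_injective {M _ _ _} h := FGModuleCat.hom_ext (LinearMap.ext fun m =>
    congrArg (fun t => t.hom.hom (S.toRes M m)) h)

instance : S.res.Full where
  map_surjective {M N} f :=
    ⟨FGModuleCat.ofHom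
      { toFun := fun m => (S.toRes N).symm (f.hom.hom (S.toRes M m))
        map_add' := fun x y => by simp
        map_smul' := fun d m => by
          obtain ⟨a, rfl⟩ := S.surjective d
          rw [← smul_toRes, map_smul]
          rfl }, rfl⟩

instance : S.res.Additive where
  map_add := rfl

lemma res_map_smul {M N : FGModuleCat.{v₁} D} (c : ℂ) (f : M ⟶ N) :
    S.res.map (c • f) = c • S.res.map f := by
  refine FGModuleCat.hom_ext (LinearMap.ext fun m => ?_)
  obtain ⟨m, rfl⟩ := (S.toRes M).surjective m
  change S.toRes N (algebraMap ℂ D c • f.hom.hom m) =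
    algebraMap ℂ A c • S.toRes N (f.hom.hom m)
  rw [smul_toRes, AlgHom.commutes]

/-- The maximal ideal of the closed point annihilates the module. -/
def Annihilates (M : FGModuleCat.{v₁} A) : Prop :=
  ∀ b, S.χ b = 0 → ∀ m : M, algebraMap B A b • m = 0

lemma annihilates_res (M : FGModuleCat.{v₁} D) : S.Annihilates (S.res.obj M) := fun b hb m => by
  obtain ⟨m, rfl⟩ := (S.toRes M).surjective m
  rw [smul_toRes, S.π_algebraMap, hb, map_zero, zero_smul, map_zero]

/-- Modules over the special fibre are preserved by every `B`-linear functor. -/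
lemma Annihilates.map {S : SpecialFibre B A D} {M : FGModuleCat.{v₁} A} (hM : S.Annihilates M)
    {X : FGModuleCat.{v₁} A ⥤ FGModuleCat.{v₁} A} (hX : CommutesWithScalars B X) :
    S.Annihilates (X.obj M) := fun b hb x => by
  have h : scalarEnd (algebraMap B A b) M = scalarEnd (algebraMap B A 0) M :=
    FGModuleCat.hom_ext (LinearMap.ext fun m => by
      simp [hM b hb m])
  have h2 := hX b M
  rw [h, hX 0 M] at h2
  have h3 := congrArg (fun t => t.hom.hom x) h2
  simpa using h3.symm

lemma Annihilates.smul_eq {S : SpecialFibre B A D} {M : FGModuleCat.{v₁} A} (hM : S.Annihilates M)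
    {a : A} (ha : S.π a = 0) (m : M) : a • m = 0 := by
  have := S.mem_of_π_eq_zero a ha
  clear ha
  induction this using Submodule.span_induction with
  | mem x hx =>
    obtain ⟨b, hb, rfl⟩ := hx
    exact hM b hb m
  | zero => exact zero_smul _ _
  | add x y _ _ hx hy => rw [add_smul, hx, hy, add_zero]
  | smul a x _ hx => rw [smul_assoc, hx, smul_zero]

/-- An `A`-module which is annihilated by the maximal ideal of the closed point is the restriction
of a `D`-module. -/
lemma Annihilates.essImage {S : SpecialFibre B A D} {M : FGModuleCat.{v₁} A}
    (hM : S.Annihilates M) : S.res.essImage M := by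
  have key : ∀ a a', S.π a = S.π a' → ∀ m : M, a • m = a' • m := fun a a' h m => by
    have := hM.smul_eq (a := a - a') (by rw [map_sub, h, sub_self]) m
    rwa [sub_smul, sub_eq_zero] at this
  let σ := Function.surjInv S.surjective
  have hσ : ∀ d, S.π (σ d) = d := Function.surjInv_eq S.surjective
  let : Module D M :=
    { smul := fun d m => σ d • m
      one_smul := fun m => (key _ 1 (by rw [hσ, map_one]) m).trans (one_smul _ m)
      mul_smul := fun d d' m =>
        (key _ (σ d * σ d') (by rw [map_mul, hσ, hσ, hσ]) m).trans (mul_smul _ _ m)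
      smul_zero := fun d => smul_zero (σ d)
      smul_add := fun d => smul_add (σ d)
      add_smul := fun d d' m =>
        (key _ (σ d + σ d') (by rw [map_add, hσ, hσ, hσ]) m).trans (add_smul _ _ m)
      zero_smul := fun m => (key _ 0 (by rw [hσ, map_zero]) m).trans (zero_smul _ m) }
  have : Module.Finite D M := Module.Finite.of_surjective (R := A) (S := D)
    (σ := S.π.toRingHom)
    ({ toFun := id, map_add' := fun _ _ => rfl, map_smul' := fun a m =>
        key a (σ (S.π a)) (hσ _).symm m } : M →ₛₗ[S.π.toRingHom] M) Function.surjective_id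
  refine ⟨FGModuleCat.of D M, ⟨isoOfLinearEquiv (M := S.res.obj (FGModuleCat.of D M))
    { toFun := fun m => (S.toRes (FGModuleCat.of D M)).symm m
      invFun := fun m => S.toRes (FGModuleCat.of D M) m
      map_add' := fun _ _ => rfl
      map_smul' := fun a m => key (σ (S.π a)) a (hσ _) _
      left_inv := fun _ => rfl
      right_inv := fun _ => rfl }⟩⟩

end SpecialFibre

/-! ### Restricting endofunctors to a full subcategory -/

section restrict

variable {𝒟 : Type u₁} [Category.{v₁} 𝒟] {𝒜 : Type u} [Category.{v} 𝒜] (R : 𝒟 ⥤ 𝒜)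
  [R.Full] [R.Faithful]

/-- The endofunctor `X` maps the essential image of `R` to itself. -/
def PreservesEssImage (X : 𝒜 ⥤ 𝒜) : Prop := ∀ M, R.essImage (X.obj (R.obj M))

variable {R}

namespace PreservesEssImage

/-- The restriction to `𝒟` of an endofunctor of `𝒜` which preserves the essential image of the fully
faithful functor `R : 𝒟 ⥤ 𝒜`. -/
noncomputable def restrict {X : 𝒜 ⥤ 𝒜} (hX : PreservesEssImage R X) : 𝒟 ⥤ 𝒟 :=
  Functor.essImage.liftFunctor (R ⋙ X) R hX

/-- The isomorphism which characterises the restriction of an endofunctor. -/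
noncomputable def restrictIso {X : 𝒜 ⥤ 𝒜} (hX : PreservesEssImage R X) :
    hX.restrict ⋙ R ≅ R ⋙ X :=
  Functor.essImage.liftFunctorCompIso (R ⋙ X) R hX

variable {X Y Z : 𝒜 ⥤ 𝒜} (hX : PreservesEssImage R X) (hY : PreservesEssImage R Y)
  (hZ : PreservesEssImage R Z)

/-- The `M`-component of `restrictIso`. -/
noncomputable def appIso (M : 𝒟) : R.obj (hX.restrict.obj M) ≅ X.obj (R.obj M) :=
  hX.restrictIso.app M

lemma map_restrict_map {M N : 𝒟} (f : M ⟶ N) :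
    R.map (hX.restrict.map f) = (hX.appIso M).hom ≫ X.map (R.map f) ≫ (hX.appIso N).inv := by
  rw [← Category.assoc, Iso.eq_comp_inv]
  exact hX.restrictIso.hom.naturality f

/-- The restriction of a natural transformation. -/
noncomputable def restrictMap (α : X ⟶ Y) : hX.restrict ⟶ hY.restrict where
  app M := R.preimage ((hX.appIso M).hom ≫ α.app (R.obj M) ≫ (hY.appIso M).inv)
  naturality M N f := R.map_injective (by simp [map_restrict_map])

@[simp]
lemma map_restrictMap_app (α : X ⟶ Y) (M : 𝒟) :
    R.map ((restrictMap hX hY α).app M) =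
      (hX.appIso M).hom ≫ α.app (R.obj M) ≫ (hY.appIso M).inv := by
  simp [restrictMap]

lemma restrictMap_id : restrictMap hX hX (𝟙 X) = 𝟙 hX.restrict :=
  NatTrans.ext (funext fun M => R.map_injective (by simp))

lemma restrictMap_comp (α : X ⟶ Y) (β : Y ⟶ Z) :
    restrictMap hX hZ (α ≫ β) = restrictMap hX hY α ≫ restrictMap hY hZ β :=
  NatTrans.ext (funext fun M => R.map_injective (by simp))

lemma restrictMap_eq_iff (α : X ⟶ Y) (β : hX.restrict ⟶ hY.restrict) :
    restrictMap hX hY α = β ↔ ∀ M, α.app (R.obj M) =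
      (hX.appIso M).inv ≫ R.map (β.app M) ≫ (hY.appIso M).hom := by
  constructor
  · rintro rfl M
    simp
  · intro h
    exact NatTrans.ext (funext fun M => R.map_injective (by simp [h]))

/-- Restriction characterises the endofunctor of `𝒟` up to isomorphism. -/
noncomputable def restrictIsoOf {X' : 𝒟 ⥤ 𝒟} (e : R ⋙ X ≅ X' ⋙ R) : hX.restrict ≅ X' :=
  NatIso.ofComponents (fun M => R.preimageIso (hX.appIso M ≪≫ e.app M)) fun {M N} f =>
    R.map_injective (by
      have := e.hom.naturality f
      dsimp at this
      simp [map_restrict_map, this])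

@[simp]
lemma map_restrictIsoOf_hom_app {X' : 𝒟 ⥤ 𝒟} (e : R ⋙ X ≅ X' ⋙ R) (M : 𝒟) :
    R.map ((hX.restrictIsoOf e).hom.app M) = (hX.appIso M).hom ≫ e.hom.app M := by
  simp [restrictIsoOf]

@[simp]
lemma map_restrictIsoOf_inv_app {X' : 𝒟 ⥤ 𝒟} (e : R ⋙ X ≅ X' ⋙ R) (M : 𝒟) :
    R.map ((hX.restrictIsoOf e).inv.app M) = e.inv.app M ≫ (hX.appIso M).inv := by
  simp [restrictIsoOf]

/-- The restriction of the identity. -/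
noncomputable def restrictId (h : PreservesEssImage R (𝟭 𝒜)) : h.restrict ≅ 𝟭 𝒟 :=
  h.restrictIsoOf (Iso.refl R)

/-- The restriction of a composite. -/
noncomputable def restrictComp (h : PreservesEssImage R (X ⋙ Y)) :
    h.restrict ≅ hX.restrict ⋙ hY.restrict :=
  h.restrictIsoOf (X := X ⋙ Y) (X' := hX.restrict ⋙ hY.restrict)
    (Functor.isoWhiskerRight hX.restrictIso.symm Y ≪≫
      Functor.isoWhiskerLeft hX.restrict hY.restrictIso.symm)

@[simp]
lemma map_restrictId_hom_app (h : PreservesEssImage R (𝟭 𝒜)) (M : 𝒟) :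
    R.map ((restrictId h).hom.app M) = (h.appIso M).hom := by
  simp [restrictId]

@[simp]
lemma map_restrictComp_hom_app (h : PreservesEssImage R (X ⋙ Y)) (M : 𝒟) :
    R.map ((restrictComp hX hY h).hom.app M) =
      (h.appIso M).hom ≫ Y.map (hX.appIso M).inv ≫ (hY.appIso (hX.restrict.obj M)).inv := by
  simp only [restrictComp, map_restrictIsoOf_hom_app]
  rfl

@[simp]
lemma map_restrictComp_inv_app (h : PreservesEssImage R (X ⋙ Y)) (M : 𝒟) :
    R.map ((restrictComp hX hY h).inv.app M) =
      (hY.appIso (hX.restrict.obj M)).hom ≫ Y.map (hX.appIso M).hom ≫ (h.appIso M).inv := by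
  simp only [restrictComp, map_restrictIsoOf_inv_app]
  simp only [← Category.assoc]
  rfl

lemma restrictMap_whiskerLeft (hXY : PreservesEssImage R (X ⋙ Y))
    (hXZ : PreservesEssImage R (X ⋙ Z)) (α : Y ⟶ Z) :
    restrictMap hXY hXZ (Functor.whiskerLeft X α) = (restrictComp hX hY hXY).hom ≫
      Functor.whiskerLeft hX.restrict (restrictMap hY hZ α) ≫ (restrictComp hX hZ hXZ).inv :=
  NatTrans.ext (funext fun M => R.map_injective (by simp))

lemma restrictMap_whiskerRight (hXZ : PreservesEssImage R (X ⋙ Z))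
    (hYZ : PreservesEssImage R (Y ⋙ Z)) (α : X ⟶ Y) :
    restrictMap hXZ hYZ (Functor.whiskerRight α Z) = (restrictComp hX hZ hXZ).hom ≫
      Functor.whiskerRight (restrictMap hX hY α) hZ.restrict ≫ (restrictComp hY hZ hYZ).inv :=
  NatTrans.ext (funext fun M => R.map_injective (by
    simp [map_restrict_map]))

lemma restrictMap_associator (hXY : PreservesEssImage R (X ⋙ Y))
    (hYZ : PreservesEssImage R (Y ⋙ Z)) (h : PreservesEssImage R ((X ⋙ Y) ⋙ Z))
    (h' : PreservesEssImage R (X ⋙ Y ⋙ Z)) :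
    restrictMap h h' (Functor.associator X Y Z).hom = (restrictComp hXY hZ h).hom ≫
      Functor.whiskerRight (restrictComp hX hY hXY).hom hZ.restrict ≫
      (Functor.associator hX.restrict hY.restrict hZ.restrict).hom ≫
      Functor.whiskerLeft hX.restrict (restrictComp hY hZ hYZ).inv ≫
      (restrictComp hX hYZ h').inv :=
  NatTrans.ext (funext fun M => R.map_injective (by
    simp [map_restrict_map]))

lemma restrictMap_leftUnitor (h1 : PreservesEssImage R (𝟭 𝒜))
    (h : PreservesEssImage R (𝟭 𝒜 ⋙ X)) :
    restrictMap h hX (Functor.leftUnitor X).hom = (restrictComp h1 hX h).hom ≫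
      Functor.whiskerRight (restrictId h1).hom hX.restrict ≫
      (Functor.leftUnitor hX.restrict).hom :=
  NatTrans.ext (funext fun M => R.map_injective (by
    simp [map_restrict_map]))

lemma restrictMap_rightUnitor (h1 : PreservesEssImage R (𝟭 𝒜))
    (h : PreservesEssImage R (X ⋙ 𝟭 𝒜)) :
    restrictMap h hX (Functor.rightUnitor X).hom = (restrictComp hX h1 h).hom ≫
      Functor.whiskerLeft hX.restrict (restrictId h1).hom ≫
      (Functor.rightUnitor hX.restrict).hom :=
  NatTrans.ext (funext fun M => R.map_injective (by simp))

end PreservesEssImage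

end restrict

/-! ### The special fibre of tensoring with `A ⊗_B A` -/

section lift

open TensorProduct

variable {B : Type w} {A : Type u} [CommRing B] [CommRing A] [Algebra B A]
  {M N : Type*} [AddCommGroup M] [Module A M] [AddCommGroup N] [Module A N]

@[elab_as_elim]
lemma bimodTensor_induction {p : A ⊗[B] (A ⊗[A] M) → Prop} (x : A ⊗[B] (A ⊗[A] M))
    (zero : p 0) (add : ∀ x y, p x → p y → p (x + y))
    (tmul : ∀ a m, p (a ⊗ₜ[B] (1 ⊗ₜ[A] m))) : p x := by
  induction x with
  | zero => exact zero
  | add x y hx hy => exact add x y hx hy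
  | tmul a z =>
    induction z with
    | zero => rwa [TensorProduct.tmul_zero]
    | add x y hx hy => rw [TensorProduct.tmul_add]; exact add _ _ hx hy
    | tmul a' m =>
      have : a' ⊗ₜ[A] m = 1 ⊗ₜ[A] (a' • m) := by
        rw [TensorProduct.tmul_smul, TensorProduct.smul_tmul', smul_eq_mul, mul_one]
      rw [this]
      exact tmul a _

/-- The `A`-linear map `a ⊗ a′ ⊗ m ↦ a g (a′ m)` induced by a `B`-linear map `g`. -/
noncomputable def bimodTensorLift (g : M →+ N)
    (hg : ∀ (b : B) m, g (algebraMap B A b • m) = algebraMap B A b • g m) :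
    A ⊗[B] (A ⊗[A] M) →ₗ[A] N :=
  letI := Module.compHom N (algebraMap B A)
  haveI : IsScalarTower B A N := ⟨fun b a n => by
    rw [Algebra.smul_def, mul_smul]; rfl⟩
  LinearMap.liftBaseChange A
    ({ toFun := fun z => g (TensorProduct.lid A M z)
       map_add' := fun x y => by simp
       map_smul' := fun b z => by
        rw [← algebraMap_smul A b z, map_smul, hg]
        rfl } : A ⊗[A] M →ₗ[B] N)

lemma bimodTensorLift_tmul (g : M →+ N)
    (hg : ∀ (b : B) m, g (algebraMap B A b • m) = algebraMap B A b • g m) (a a' : A) (m : M) :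
    bimodTensorLift g hg (a ⊗ₜ[B] (a' ⊗ₜ[A] m)) = a • g (a' • m) := by
  simp [bimodTensorLift]

end lift

section unit

variable (B : Type w) (A : Type u) [CommRing B] [CommRing A] [Algebra B A] [Module.Finite B A]

/-- The additive map `m ↦ 1 ⊗ 1 ⊗ m` from `M` to `A ⊗_B A ⊗_A M`. It is the universal `B`-linear map
from `M` to an `A`-module. -/
noncomputable def tensorUnit (M : FGModuleCat.{max u v} A) :
    M →+ (bimodTensorFunctor.{w, v} B A).obj M where
  toFun m := (1 : A) ⊗ₜ[B] ((1 : A) ⊗ₜ[A] m)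
  map_zero' := by
    rw [TensorProduct.tmul_zero, TensorProduct.tmul_zero]
    rfl
  map_add' _ _ := by
    rw [TensorProduct.tmul_add, TensorProduct.tmul_add]
    rfl

variable {B A}

lemma tensorUnit_algebraMap (M : FGModuleCat.{max u v} A) (b : B) (m : M) :
    tensorUnit.{w, v} B A M (algebraMap B A b • m) =
      algebraMap B A b • tensorUnit.{w, v} B A M m := by
  change (1 : A) ⊗ₜ[B] ((1 : A) ⊗ₜ[A] (algebraMap B A b • m)) =
      algebraMap B A b • ((1 : A) ⊗ₜ[B] ((1 : A) ⊗ₜ[A] m))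
  rw [TensorProduct.tmul_smul, algebraMap_smul, algebraMap_smul, TensorProduct.tmul_smul]

@[simp]
lemma map_tensorUnit {M N : FGModuleCat.{max u v} A} (f : M ⟶ N) (m : M) :
    ((bimodTensorFunctor.{w, v} B A).map f).hom.hom (tensorUnit.{w, v} B A M m) =
      tensorUnit.{w, v} B A N (f.hom.hom m) := rfl

@[elab_as_elim]
lemma tensorUnit_induction {M : FGModuleCat.{max u v} A}
    {p : (bimodTensorFunctor.{w, v} B A).obj M → Prop}
    (x : (bimodTensorFunctor.{w, v} B A).obj M)
    (zero : p 0) (add : ∀ x y, p x → p y → p (x + y))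
    (smul : ∀ (a : A) (m : M), p (a • tensorUnit.{w, v} B A M m)) : p x :=
  bimodTensor_induction (B := B) (A := A) (M := M) x zero add fun a m => by
    have := smul a m
    have h : a • tensorUnit.{w, v} B A M m = (a • (1 : A)) ⊗ₜ[B] ((1 : A) ⊗ₜ[A] m) := rfl
    rwa [h, smul_eq_mul, mul_one] at this

lemma tensorUnit_hom_ext {M N : FGModuleCat.{max u v} A}
    {f g : (bimodTensorFunctor.{w, v} B A).obj M ⟶ N}
    (h : ∀ m, f.hom.hom (tensorUnit.{w, v} B A M m) = g.hom.hom (tensorUnit.{w, v} B A M m)) :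
    f = g :=
  FGModuleCat.hom_ext (LinearMap.ext fun x => by
    induction x using tensorUnit_induction with
    | zero => rw [map_zero, map_zero]
    | add x y hx hy => rw [map_add, hx, hy, map_add]
    | smul a m => rw [map_smul, h, map_smul])

/-- The morphism `A ⊗_B A ⊗_A M ⟶ N` induced by a `B`-linear map `M → N`. -/
noncomputable def tensorDesc {M N : FGModuleCat.{max u v} A} (g : M →+ N)
    (hg : ∀ (b : B) m, g (algebraMap B A b • m) = algebraMap B A b • g m) :
    (bimodTensorFunctor.{w, v} B A).obj M ⟶ N :=
  homOfLinear (bimodTensorLift g hg)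

@[simp]
lemma tensorDesc_tensorUnit {M N : FGModuleCat.{max u v} A} (g : M →+ N)
    (hg : ∀ (b : B) m, g (algebraMap B A b • m) = algebraMap B A b • g m) (m : M) :
    (tensorDesc.{w, v} g hg).hom.hom (tensorUnit.{w, v} B A M m) = g m := by
  refine (bimodTensorLift_tmul g hg 1 1 m).trans ?_
  rw [one_smul, one_smul]

end unit

namespace SpecialFibre

variable {B : Type u} {A : Type u} {D : Type} [CommRing B] [CommRing A] [CommRing D]
    [Algebra B A] [Algebra ℂ B] [Algebra ℂ A] [Algebra ℂ D] [Module.Finite B A]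
    [Module.Finite ℂ D] (S : SpecialFibre B A D)

/-- The map `a ⊗ a′ ⊗ m ↦ π a ⊗ π a′ ⊗ m`. -/
noncomputable def tensorHom (M : FGModuleCat.{u} D) :
    (bimodTensorFunctor.{u, u} B A).obj (S.res.obj M) ⟶
      S.res.obj ((bimodTensorFunctor.{0, u} ℂ D).obj M) :=
  tensorDesc.{u, u}
    (((S.toRes ((bimodTensorFunctor.{0, u} ℂ D).obj M)).toAddMonoidHom.comp
      (tensorUnit.{0, u} ℂ D M)).comp (S.toRes M).symm.toAddMonoidHom)
    (fun b m => by
      obtain ⟨m, rfl⟩ := (S.toRes M).surjective m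
      have := tensorUnit_algebraMap.{0, u} (A := D) M (S.χ b) m
      rw [← S.π_algebraMap] at this
      exact congrArg (S.toRes ((bimodTensorFunctor.{0, u} ℂ D).obj M)) this)

@[simp]
lemma tensorHom_tensorUnit (M : FGModuleCat.{u} D) (m : M) :
    (S.tensorHom M).hom.hom (tensorUnit.{u, u} B A (S.res.obj M) (S.toRes M m)) =
      S.toRes ((bimodTensorFunctor.{0, u} ℂ D).obj M) (tensorUnit.{0, u} ℂ D M m) :=
  tensorDesc_tensorUnit _ _ _

lemma isIso_tensorHom (M : FGModuleCat.{u} D) : IsIso (S.tensorHom M) := by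
  have hF := (S.annihilates_res M).map (bimodTensorFunctor_commutesWithScalars (B := B) (A := A))
  -- The source is the restriction of a `D`-module `N`, so the inverse can be built over `D`.
  obtain ⟨N, ⟨e⟩⟩ := hF.essImage
  let g : M →+ N := ((S.toRes N).symm.toAddMonoidHom.comp e.inv.hom.hom.toAddMonoidHom).comp
    ((tensorUnit.{u, u} B A (S.res.obj M)).comp (S.toRes M).toAddMonoidHom)
  have hg : ∀ m, S.toRes N (g m) = e.inv.hom.hom (tensorUnit.{u, u} B A _ (S.toRes M m)) :=
    fun m => rfl
  have he : ∀ x, e.hom.hom.hom (e.inv.hom.hom x) = x := fun x =>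
    congrArg (fun t => t.hom.hom x) e.inv_hom_id
  let ψ : (bimodTensorFunctor.{0, u} ℂ D).obj M ⟶ N := tensorDesc.{0, u} g fun c m => by
    apply (S.toRes N).injective
    have h1 : S.toRes M (algebraMap ℂ D c • m) =
        algebraMap B A (algebraMap ℂ B c) • S.toRes M m := by
      rw [smul_toRes, S.π_algebraMap, AlgHom.commutes]
      rfl
    have h2 : algebraMap ℂ D c = S.π (algebraMap B A (algebraMap ℂ B c)) := by
      rw [S.π_algebraMap, AlgHom.commutes]
      rfl
    rw [hg, h1, tensorUnit_algebraMap, map_smul, ← hg, h2, smul_toRes]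
  refine ⟨S.res.map ψ ≫ e.hom, tensorUnit_hom_ext fun m => ?_, ?_⟩
  · obtain ⟨m, rfl⟩ := (S.toRes M).surjective m
    simp [ψ, hg, he]
  · obtain ⟨φ, hφ⟩ := S.res.map_surjective (e.hom ≫ S.tensorHom M)
    rw [Category.assoc, ← hφ, ← S.res.map_comp, ← S.res.map_id]
    refine congrArg S.res.map (tensorUnit_hom_ext fun m => ?_)
    have h := congrArg (fun t => t.hom.hom (S.toRes N (g m))) hφ
    rw [res_map_toRes, hg] at h
    simp only [FGModuleCat.hom_hom_comp, LinearMap.comp_apply, he, tensorHom_tensorUnit] at h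
    apply (S.toRes _).injective
    simpa [ψ] using h

/-- The functor `A ⊗_B A ⊗_A _` restricts to `D ⊗_ℂ D ⊗_D _` on modules over the special fibre. -/
noncomputable def tensorIso : S.res ⋙ bimodTensorFunctor.{u, u} B A ≅
    bimodTensorFunctor.{0, u} ℂ D ⋙ S.res :=
  haveI := S.isIso_tensorHom
  NatIso.ofComponents (fun M => asIso (S.tensorHom M)) fun {M N} f =>
    tensorUnit_hom_ext fun m => by
      obtain ⟨m, rfl⟩ := (S.toRes M).surjective m
      simp

end SpecialFibre

/-! ### The special fibre of the 2-category -/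

namespace PreservesEssImage

variable {𝒟 : Type u₁} [Category.{v₁} 𝒟] [Preadditive 𝒟] {𝒜 : Type u} [Category.{v} 𝒜]
  [Preadditive 𝒜] {R : 𝒟 ⥤ 𝒜} [R.Full] [R.Faithful] [R.Additive] {X Y : 𝒜 ⥤ 𝒜}
  (hX : PreservesEssImage R X) (hY : PreservesEssImage R Y)

lemma restrictMap_add (α β : X ⟶ Y) :
    restrictMap hX hY (α + β) = restrictMap hX hY α + restrictMap hX hY β :=
  NatTrans.ext (funext fun M => R.map_injective (by
    simp [R.map_add, Preadditive.add_comp, Preadditive.comp_add]))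

lemma restrictMap_sum {ι : Type*} (s : Finset ι) (α : ι → (X ⟶ Y)) :
    restrictMap hX hY (∑ i ∈ s, α i) = ∑ i ∈ s, restrictMap hX hY (α i) :=
  map_sum (AddMonoidHom.mk' (restrictMap hX hY) (restrictMap_add hX hY)) α s

end PreservesEssImage

namespace SpecialFibre

open PreservesEssImage

variable {B : Type u} {A : Type u} {D : Type} [CommRing B] [CommRing A] [CommRing D]
    [Algebra B A] [Algebra ℂ B] [Algebra ℂ A] [Algebra ℂ D] [Module.Finite B A]
    [Module.Finite ℂ D] (S : SpecialFibre B A D)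

omit [Module.Finite ℂ D] in
lemma preservesEssImage {X : FGModuleCat.{u} A ⥤ FGModuleCat.{u} A}
    (hX : additiveClosure (tensorGenerators.{u, u} B A) X) : PreservesEssImage S.res X := fun M =>
  ((S.annihilates_res M).map (CommutesWithScalars.of_additiveClosure
    (fun _ h => tensorGenerators_commutesWithScalars h) hX)).essImage

lemma exists_restrict_iso {X : FGModuleCat.{u} A ⥤ FGModuleCat.{u} A}
    (hX : tensorGenerators.{u, u} B A X) (h : PreservesEssImage S.res X) :
    ∃ X', tensorGenerators.{0, u} ℂ D X' ∧ Nonempty (h.restrict ≅ X') := by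
  obtain rfl | rfl := hX
  · exact ⟨_, Or.inl rfl, ⟨restrictId h⟩⟩
  · exact ⟨_, Or.inr rfl, ⟨h.restrictIsoOf S.tensorIso⟩⟩

lemma exists_iso_restrict [IsNoetherianRing A] {X' : FGModuleCat.{u} D ⥤ FGModuleCat.{u} D}
    (hX : tensorGenerators.{0, u} ℂ D X') : ∃ (X : FGModuleCat.{u} A ⥤ FGModuleCat.{u} A)
      (_ : tensorGenerators.{u, u} B A X) (h : PreservesEssImage S.res X),
      Nonempty (h.restrict ≅ X') := by
  have := hasFiniteBiproducts_functor.{u} (A := A)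
  obtain rfl | rfl := hX
  · exact ⟨_, Or.inl rfl, S.preservesEssImage (additiveClosure_of_mem (Or.inl rfl)),
      ⟨restrictId _⟩⟩
  · exact ⟨_, Or.inr rfl, S.preservesEssImage (additiveClosure_of_mem (Or.inr rfl)),
      ⟨restrictIsoOf _ S.tensorIso⟩⟩

lemma restrict_mem [IsNoetherianRing A] {X : FGModuleCat.{u} A ⥤ FGModuleCat.{u} A}
    (hX : additiveClosure (tensorGenerators.{u, u} B A) X) :
    additiveClosure (tensorGenerators.{0, u} ℂ D) (S.preservesEssImage hX).restrict := by
  have := IsNoetherianRing.of_finite ℂ D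
  have := hasFiniteBiproducts_functor.{u} (A := D)
  have := hasFiniteBiproducts_functor.{u} (A := A)
  obtain ⟨n, T, p, q, hT, h⟩ := hX.exists_sum
  have hT' := fun i => S.preservesEssImage (additiveClosure_of_mem (hT i))
  choose T' hT'' e using fun i => S.exists_restrict_iso (hT i) (hT' i)
  have e := fun i => (e i).some
  refine additiveClosure_of_sum T' (fun i => restrictMap _ (hT' i) (p i) ≫ (e i).hom)
    (fun i => (e i).inv ≫ restrictMap (hT' i) _ (q i)) hT'' ?_
  simp only [Category.assoc, Iso.hom_inv_id_assoc, ← restrictMap_comp]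
  rw [← restrictMap_sum, h, restrictMap_id]

variable [Module.Free B A] [Module.Finite ℂ A] [Module.Free ℂ D]

open TensorTwoCat

/-- The pseudofunctor which restricts endofunctors of the category of `A`-modules to the modules
over the special fibre. -/
noncomputable def restriction :
    Pseudofunctor (TensorTwoCat.{u, u, u} B A) (TensorTwoCat.{0, u, 0} ℂ D) :=
  haveI := IsNoetherianRing.of_finite ℂ A
  { obj := fun _ => ⟨⟩
    map := fun X => ⟨(S.preservesEssImage X.property).restrict, S.restrict_mem X.property⟩
    map₂ := fun {_ _ X Y} α => ofNatTrans (restrictMap (S.preservesEssImage X.property)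
      (S.preservesEssImage Y.property) (toNatTrans α))
    map₂_id := fun _ => ObjectProperty.hom_ext _ (restrictMap_id _)
    map₂_comp := fun _ _ => ObjectProperty.hom_ext _ (restrictMap_comp _ _ _ _ _)
    mapId := fun _ => ofNatIso (restrictId _)
    mapComp := fun _ _ => ofNatIso (restrictComp _ _ _)
    map₂_whisker_left := fun _ _ _ α =>
      ObjectProperty.hom_ext _ (restrictMap_whiskerLeft _ _ _ _ _ (toNatTrans α))
    map₂_whisker_right := fun α _ =>
      ObjectProperty.hom_ext _ (restrictMap_whiskerRight _ _ _ _ _ (toNatTrans α))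
    map₂_associator := fun _ _ _ =>
      ObjectProperty.hom_ext _ (restrictMap_associator _ _ _ _ _ _ _)
    map₂_left_unitor := fun _ => ObjectProperty.hom_ext _ (restrictMap_leftUnitor _ _ _)
    map₂_right_unitor := fun _ => ObjectProperty.hom_ext _ (restrictMap_rightUnitor _ _ _) }

end SpecialFibre

/-! ### Natural transformations out of the generating functors -/

section elements

variable {A : Type u} [CommRing A]

/-- The morphism `A ⟶ M` which sends `1` to `m`. -/
noncomputable def elementHom {M : FGModuleCat.{u} A} (m : M) : FGModuleCat.of A A ⟶ M :=
  homOfLinear (M := FGModuleCat.of A A) (LinearMap.toSpanSingleton A M m)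

lemma elementHom_comp {M N : FGModuleCat.{u} A} (m : M) (f : M ⟶ N) :
    elementHom m ≫ f = elementHom (f.hom.hom m) :=
  FGModuleCat.hom_ext (LinearMap.ext fun a => f.hom.hom.map_smul a m)

lemma elementHom_add {M : FGModuleCat.{u} A} (m m' : M) :
    elementHom (m + m') = elementHom m + elementHom m' :=
  FGModuleCat.hom_ext (LinearMap.ext fun a => smul_add a m m')

lemma elementHom_smul {M : FGModuleCat.{u} A} (a : A) (m : M) :
    elementHom (a • m) = scalarEnd a _ ≫ elementHom m :=
  FGModuleCat.hom_ext (LinearMap.ext fun c => by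
    change c • a • m = (a * c) • m
    rw [smul_smul, mul_comm])

/-- The additive map `m ↦ X(a ↦ a m)(s)`, for an element `s` of `X A`. -/
noncomputable def elementMap (X : FGModuleCat.{u} A ⥤ FGModuleCat.{u} A) [X.Additive]
    (s : X.obj (FGModuleCat.of A A)) (M : FGModuleCat.{u} A) : M →+ X.obj M :=
  AddMonoidHom.mk' (fun m => (X.map (elementHom m)).hom.hom s) fun m m' => by
    rw [elementHom_add, X.map_add]
    rfl

lemma elementMap_apply (X : FGModuleCat.{u} A ⥤ FGModuleCat.{u} A) [X.Additive]
    (s : X.obj (FGModuleCat.of A A)) {M : FGModuleCat.{u} A} (m : M) :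
    elementMap X s M m = (X.map (elementHom m)).hom.hom s := rfl

lemma elementMap_algebraMap {B : Type w} [CommRing B] [Algebra B A]
    {X : FGModuleCat.{u} A ⥤ FGModuleCat.{u} A} [X.Additive] (hX : CommutesWithScalars B X)
    (s : X.obj (FGModuleCat.of A A)) {M : FGModuleCat.{u} A} (b : B) (m : M) :
    elementMap X s M (algebraMap B A b • m) = algebraMap B A b • elementMap X s M m :=
  hX.map_apply (fun c => by
    change c • algebraMap B A b • m = algebraMap B A b • c • m
    rw [smul_comm]) s

lemma map_elementMap (X : FGModuleCat.{u} A ⥤ FGModuleCat.{u} A) [X.Additive]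
    (s : X.obj (FGModuleCat.of A A)) {M N : FGModuleCat.{u} A} (f : M ⟶ N) (m : M) :
    (X.map f).hom.hom (elementMap X s M m) = elementMap X s N (f.hom.hom m) := by
  rw [elementMap_apply, elementMap_apply, ← elementHom_comp, X.map_comp]
  rfl

/-- The natural transformation out of the identity functor given by a central element `s` of the
bimodule `X A`, that is, one on which the action of `A` by functoriality agrees with the action of
`A` on the module `X A`. -/
noncomputable def idDesc (X : FGModuleCat.{u} A ⥤ FGModuleCat.{u} A) [X.Additive]
    (s : X.obj (FGModuleCat.of A A))
    (hs : ∀ a, (X.map (scalarEnd a _)).hom.hom s = a • s) : 𝟭 _ ⟶ X where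
  app M := homOfLinear
    { toFun := elementMap X s M
      map_add' := map_add _
      map_smul' := fun a m => by
        rw [elementMap_apply, elementHom_smul, X.map_comp]
        refine (congrArg (X.map (elementHom m)).hom.hom (hs a)).trans ?_
        rw [map_smul]
        rfl }
  naturality _ _ f := FGModuleCat.hom_ext (LinearMap.ext fun m => (map_elementMap X s f m).symm)

variable {B : Type u} [CommRing B] [Algebra B A] [Module.Finite B A]

/-- The natural transformation out of `A ⊗_B A ⊗_A _` which is given by an element of `X A`. -/
noncomputable def tensorFunctorDesc (X : FGModuleCat.{u} A ⥤ FGModuleCat.{u} A) [X.Additive]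
    (hX : CommutesWithScalars B X) (s : X.obj (FGModuleCat.of A A)) :
    bimodTensorFunctor.{u, u} B A ⟶ X where
  app M := tensorDesc.{u, u} (elementMap X s M) (elementMap_algebraMap hX s)
  naturality M N f := tensorUnit_hom_ext fun m => by
    refine (tensorDesc_tensorUnit _ (elementMap_algebraMap hX s) _).trans
      ((map_elementMap X s f m).symm.trans ?_)
    exact congrArg (X.map f).hom.hom
      (tensorDesc_tensorUnit _ (elementMap_algebraMap hX s) _).symm

@[simp]
lemma tensorFunctorDesc_app_tensorUnit (X : FGModuleCat.{u} A ⥤ FGModuleCat.{u} A) [X.Additive]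
    (hX : CommutesWithScalars B X) (s : X.obj (FGModuleCat.of A A)) {M : FGModuleCat.{u} A}
    (m : M) :
    ((tensorFunctorDesc X hX s).app M).hom.hom (tensorUnit.{u, u} B A M m) =
      (X.map (elementHom m)).hom.hom s :=
  tensorDesc_tensorUnit _ _ _

/-- The element `t` of `T A` generates the functor `T`: morphisms out of `T M` are determined by
their values at the images of `t` under the maps `T (a ↦ a m)`. -/
def Generates (T : FGModuleCat.{u} A ⥤ FGModuleCat.{u} A)
    (t : T.obj (FGModuleCat.of A A)) : Prop :=
  ∀ ⦃M N : FGModuleCat.{u} A⦄ (f g : T.obj M ⟶ N),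
    (∀ m : M, f.hom.hom ((T.map (elementHom m)).hom.hom t) =
      g.hom.hom ((T.map (elementHom m)).hom.hom t)) → f = g

lemma Generates.natTrans_ext {T X : FGModuleCat.{u} A ⥤ FGModuleCat.{u} A}
    {t : T.obj (FGModuleCat.of A A)} (ht : Generates T t) {α β : T ⟶ X}
    (h : (α.app (FGModuleCat.of A A)).hom.hom t = (β.app (FGModuleCat.of A A)).hom.hom t) :
    α = β :=
  NatTrans.ext (funext fun M => ht _ _ fun m => by
    have h1 := congrArg (fun φ => φ.hom.hom t) (α.naturality (elementHom m))
    have h2 := congrArg (fun φ => φ.hom.hom t) (β.naturality (elementHom m))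
    exact h1.trans ((congrArg (X.map (elementHom m)).hom.hom h).trans h2.symm))

lemma generates_id : Generates (A := A) (𝟭 _) (1 : A) := fun M N f g h =>
  FGModuleCat.hom_ext (LinearMap.ext fun m => by
    have e : (elementHom m).hom.hom (1 : A) = m := one_smul A m
    exact (congrArg f.hom.hom e).symm.trans ((h m).trans (congrArg g.hom.hom e)))

lemma generates_tensor : Generates (bimodTensorFunctor.{u, u} B A)
    (tensorUnit.{u, u} B A (FGModuleCat.of A A) (1 : A)) := fun M N f g h =>
  tensorUnit_hom_ext fun m => by
    have e := congrArg (tensorUnit.{u, u} B A M) (one_smul A m)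
    exact (congrArg f.hom.hom e).symm.trans ((h m).trans (congrArg g.hom.hom e))

lemma tensorGenerators.exists_generates {T : FGModuleCat.{u} A ⥤ FGModuleCat.{u} A}
    (hT : tensorGenerators.{u, u} B A T) : ∃ t, Generates T t := by
  obtain rfl | rfl := hT
  · exact ⟨_, generates_id⟩
  · exact ⟨_, generates_tensor⟩

lemma bimodTensorFunctor_map_surjective {M N : FGModuleCat.{u} A} {f : M ⟶ N}
    (hf : Function.Surjective f.hom.hom) :
    Function.Surjective ((bimodTensorFunctor.{u, u} B A).map f).hom.hom := fun x => by
  induction x using tensorUnit_induction with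
  | zero => exact ⟨0, map_zero _⟩
  | add x y hx hy =>
    obtain ⟨x, rfl⟩ := hx
    obtain ⟨y, rfl⟩ := hy
    exact ⟨x + y, map_add _ _ _⟩
  | smul a m =>
    obtain ⟨m, rfl⟩ := hf m
    exact ⟨a • tensorUnit.{u, u} B A M m, by rw [map_smul, map_tensorUnit]⟩

lemma tensorGenerators.map_surjective {T : FGModuleCat.{u} A ⥤ FGModuleCat.{u} A}
    (hT : tensorGenerators.{u, u} B A T) {M N : FGModuleCat.{u} A} {f : M ⟶ N}
    (hf : Function.Surjective f.hom.hom) : Function.Surjective (T.map f).hom.hom := by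
  obtain rfl | rfl := hT
  · exact hf
  · exact bimodTensorFunctor_map_surjective hf

end elements

/-! ### Linear forms -/

section forms

open TensorProduct

variable {B A : Type u} [CommRing B] [CommRing A] [Algebra B A] [Module.Finite B A]

/-- The additive map `a ⊗ a′ ⊗ m ↦ φ(a) a′ m`. -/
noncomputable def formEval (φ : A →ₗ[B] B) (M : FGModuleCat.{u} A) :
    (bimodTensorFunctor.{u, u} B A).obj M →+ M :=
  ((TensorProduct.lid A M).toLinearMap.toAddMonoidHom.comp
    (TensorProduct.lid B (A ⊗[A] M)).toLinearMap.toAddMonoidHom).comp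
      (φ.rTensor (A ⊗[A] M)).toAddMonoidHom

@[simp]
lemma formEval_smul_tensorUnit (φ : A →ₗ[B] B) {M : FGModuleCat.{u} A} (a : A) (m : M) :
    formEval φ M (a • tensorUnit.{u, u} B A M m) = algebraMap B A (φ a) • m := by
  have h : a • tensorUnit.{u, u} B A M m = (a * (1 : A)) ⊗ₜ[B] ((1 : A) ⊗ₜ[A] m) := rfl
  rw [h, mul_one]
  change TensorProduct.lid A M (φ a • ((1 : A) ⊗ₜ[A] m)) = _
  rw [← algebraMap_smul A, map_smul, TensorProduct.lid_tmul, one_smul]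

lemma formEval_map (φ : A →ₗ[B] B) {M N : FGModuleCat.{u} A} (g : M ⟶ N)
    (x : (bimodTensorFunctor.{u, u} B A).obj M) :
    formEval φ N (((bimodTensorFunctor.{u, u} B A).map g).hom.hom x) =
      g.hom.hom (formEval φ M x) := by
  induction x using tensorUnit_induction with
  | zero => simp
  | add x y hx hy => simp only [map_add, hx, hy]
  | smul a m =>
    rw [map_smul, map_tensorUnit, formEval_smul_tensorUnit, formEval_smul_tensorUnit, map_smul]

/-- If the elements `eᵢ` and the linear forms `φᵢ` are dual bases of `A` over `B`, they induce dual
bases of `A ⊗_B M`. -/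
lemma sum_smul_tensorUnit_formEval {ι : Type*} [Fintype ι] (e : ι → A) (φ : ι → A →ₗ[B] B)
    (h : ∀ a, ∑ i, algebraMap B A (φ i a) * e i = a) {M : FGModuleCat.{u} A}
    (x : (bimodTensorFunctor.{u, u} B A).obj M) :
    ∑ i, e i • tensorUnit.{u, u} B A M (formEval (φ i) M x) = x := by
  induction x using tensorUnit_induction with
  | zero => simp
  | add x y hx hy =>
    simp only [smul_add, map_add, Finset.sum_add_distrib]
    rw [hx, hy]
  | smul a m =>
    simp only [smul_smul, formEval_smul_tensorUnit, tensorUnit_algebraMap]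
    rw [← Finset.sum_smul]
    congr 1
    simpa only [mul_comm] using h a

end forms

/-! ### Frobenius extensions -/

/-- A Frobenius system for the extension `B → A`: a `B`-linear form on `A` and two finite families
of elements of `A` which are dual bases for it. -/
structure FrobeniusSystem (B : Type w) (A : Type u) [CommRing B] [CommRing A] [Algebra B A] where
  /-- The linear form. -/
  form : A →ₗ[B] B
  /-- The number of elements of the dual bases. -/
  n : ℕ
  /-- The first basis. -/
  e : Fin n → A
  /-- The second basis. -/
  f : Fin n → A
  sum_e : ∀ a, ∑ i, algebraMap B A (form (f i * a)) * e i = a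
  sum_f : ∀ a, ∑ i, algebraMap B A (form (a * e i)) * f i = a

namespace FrobeniusSystem

variable {B A : Type u} [CommRing B] [CommRing A] [Algebra B A] [Module.Finite B A]
  (F : FrobeniusSystem B A)

lemma sum_smul_tensorUnit_eval {M : FGModuleCat.{u} A}
    (x : (bimodTensorFunctor.{u, u} B A).obj M) :
    ∑ i, F.e i • tensorUnit.{u, u} B A M (formEval F.form M (F.f i • x)) = x := by
  have h := sum_smul_tensorUnit_formEval F.e (fun i => F.form ∘ₗ LinearMap.mulLeft B (F.f i))
    F.sum_e x
  have h1 : ∀ i (y : (bimodTensorFunctor.{u, u} B A).obj M),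
      formEval (F.form ∘ₗ LinearMap.mulLeft B (F.f i)) M y = formEval F.form M (F.f i • y) :=
    fun i y => by
      induction y using tensorUnit_induction with
      | zero => simp
      | add x y hx hy => simp only [smul_add, map_add, hx, hy]
      | smul a m =>
        rw [smul_smul, formEval_smul_tensorUnit, formEval_smul_tensorUnit]
        rfl
  simpa only [h1] using h

/-- The Casimir element `∑ eᵢ ⊗ fᵢ` of `A ⊗_B A`, acting on `m`. -/
noncomputable def casimir {M : FGModuleCat.{u} A} (m : M) : (bimodTensorFunctor.{u, u} B A).obj M :=
  ∑ i, F.e i • tensorUnit.{u, u} B A M (F.f i • m)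

lemma map_casimir {M N : FGModuleCat.{u} A} (g : M ⟶ N) (m : M) :
    ((bimodTensorFunctor.{u, u} B A).map g).hom.hom (F.casimir m) = F.casimir (g.hom.hom m) := by
  simp [casimir]

lemma smul_casimir {M : FGModuleCat.{u} A} (a : A) (m : M) :
    a • F.casimir m = F.casimir (a • m) := by
  have h1 : ∀ i, a • F.e i • tensorUnit.{u, u} B A M (F.f i • m) =
      ∑ j, (algebraMap B A (F.form (F.f j * (a * F.e i))) * F.e j) •
        tensorUnit.{u, u} B A M (F.f i • m) := fun i => by
    rw [← Finset.sum_smul, F.sum_e, smul_smul]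
  have h2 : ∀ j, F.e j • tensorUnit.{u, u} B A M (F.f j • a • m) =
      ∑ i, (algebraMap B A (F.form (F.f j * (a * F.e i))) * F.e j) •
        tensorUnit.{u, u} B A M (F.f i • m) := fun j => by
    rw [smul_smul]
    conv_lhs => rw [← F.sum_f (F.f j * a), Finset.sum_smul, map_sum, Finset.smul_sum]
    refine Finset.sum_congr rfl fun i _ => ?_
    rw [mul_smul, tensorUnit_algebraMap, smul_smul, mul_comm, mul_assoc]
  rw [casimir, casimir, Finset.smul_sum, Finset.sum_congr rfl fun i _ => h1 i,
    Finset.sum_congr rfl fun j _ => h2 j, Finset.sum_comm]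

end FrobeniusSystem

/-! ### Lifting 2-morphisms from the special fibre -/

namespace SpecialFibre

open PreservesEssImage

variable {B : Type u} {A : Type u} {D : Type} [CommRing B] [CommRing A] [CommRing D]
    [Algebra B A] [Algebra ℂ B] [Algebra ℂ A] [Algebra ℂ D] (S : SpecialFibre B A D)

/-- The free `D`-module on one generator, lifted to the universe of the modules under
consideration. -/
abbrev regular (D : Type) [CommRing D] : FGModuleCat.{u} D := FGModuleCat.of D (ULift.{u} D)

/-- The generator of the regular `D`-module, as an `A`-module. -/
noncomputable def point : S.res.obj (regular.{u} D) := S.toRes (regular.{u} D) (ULift.up (1 : D))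

lemma elementHom_point_surjective : Function.Surjective (elementHom S.point).hom.hom := fun x => by
  obtain ⟨⟨d⟩, rfl⟩ := (S.toRes (regular.{u} D)).surjective x
  obtain ⟨a, rfl⟩ := S.surjective d
  exact ⟨a, congrArg (fun t => S.toRes (regular.{u} D) (ULift.up t)) (mul_one (S.π a))⟩

lemma exists_map_point {M : FGModuleCat.{u} D} (m : S.res.obj M) :
    ∃ g : regular.{u} D ⟶ M, (S.res.map g).hom.hom S.point = m := by
  obtain ⟨m, rfl⟩ := (S.toRes M).surjective m
  refine ⟨homOfLinear (M := regular.{u} D)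
    ((LinearMap.toSpanSingleton D M m).comp ULift.moduleEquiv.toLinearMap), ?_⟩
  exact congrArg (S.toRes M) (one_smul D m)

/-- A natural transformation of restricted functors is determined by its value at the image of a
generator. -/
lemma hom_ext_of_generates {T X : FGModuleCat.{u} A ⥤ FGModuleCat.{u} A}
    {t : T.obj (FGModuleCat.of A A)} (ht : Generates T t) {β β' : S.res ⋙ T ⟶ S.res ⋙ X}
    {t' : T.obj (S.res.obj (regular.{u} D))}
    (ht' : (T.map (elementHom S.point)).hom.hom t = t')
    (h : (β.app (regular.{u} D)).hom.hom t' = (β'.app (regular.{u} D)).hom.hom t') : β = β' := by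
  refine NatTrans.ext (funext fun M => ht _ _ fun m => ?_)
  obtain ⟨g, rfl⟩ := S.exists_map_point m
  rw [← elementHom_comp, T.map_comp]
  have h1 := congrArg (fun φ => φ.hom.hom ((T.map (elementHom S.point)).hom.hom t))
    (β.naturality g)
  have h2 := congrArg (fun φ => φ.hom.hom ((T.map (elementHom S.point)).hom.hom t))
    (β'.naturality g)
  rw [← ht'] at h
  exact h1.trans ((congrArg (X.map (S.res.map g)).hom.hom h).trans h2.symm)

lemma id_hom_ext {X : FGModuleCat.{u} A ⥤ FGModuleCat.{u} A}
    {β β' : S.res ⋙ 𝟭 _ ⟶ S.res ⋙ X}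
    (h : (β.app (regular.{u} D)).hom.hom S.point = (β'.app (regular.{u} D)).hom.hom S.point) :
    β = β' :=
  S.hom_ext_of_generates generates_id (one_smul A S.point) h

variable [Module.Finite B A]

lemma tensor_hom_ext {X : FGModuleCat.{u} A ⥤ FGModuleCat.{u} A}
    {β β' : S.res ⋙ bimodTensorFunctor.{u, u} B A ⟶ S.res ⋙ X}
    (h : (β.app (regular.{u} D)).hom.hom (tensorUnit.{u, u} B A _ S.point) =
      (β'.app (regular.{u} D)).hom.hom (tensorUnit.{u, u} B A _ S.point)) : β = β' :=
  S.hom_ext_of_generates generates_tensor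
    (congrArg (tensorUnit.{u, u} B A _) (one_smul A S.point)) h

/-- The value at the point of a natural transformation from the identity to `A ⊗_B A ⊗_A _` is a
multiple of the Casimir element. Indeed it is a central element `s`, and expanding it in the dual
bases gives `s = ∑ eᵢ ⊗ (form ⊗ 1)(fᵢ s) = ∑ eᵢ ⊗ fᵢ (form ⊗ 1)(s)`. -/
lemma exists_casimir_eq (F : FrobeniusSystem B A)
    (β : S.res ⋙ 𝟭 _ ⟶ S.res ⋙ bimodTensorFunctor.{u, u} B A) :
    ∃ c, F.casimir c = (β.app (regular.{u} D)).hom.hom S.point := by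
  let s : (bimodTensorFunctor.{u, u} B A).obj (S.res.obj (regular.{u} D)) :=
    (β.app (regular.{u} D)).hom.hom S.point
  have hs : ∀ a : A, a • s = ((bimodTensorFunctor.{u, u} B A).map
      (scalarEnd a (S.res.obj (regular.{u} D)))).hom.hom s := fun a => by
    have h1 : S.res.map (scalarEnd (S.π a) (regular.{u} D)) =
      scalarEnd a (S.res.obj (regular.{u} D)) := rfl
    have h2 := congrArg (fun φ => φ.hom.hom S.point)
      (β.naturality (scalarEnd (S.π a) (regular.{u} D)))
    have h3 : (β.app (regular.{u} D)).hom.hom (a • S.point) = a • s := map_smul _ _ _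
    exact h3.symm.trans h2
  refine ⟨formEval F.form _ s, ?_⟩
  refine Eq.trans ?_ (F.sum_smul_tensorUnit_eval s)
  refine Finset.sum_congr rfl fun i _ => ?_
  rw [hs, formEval_map]
  rfl

/-- Natural transformations between the generating functors lift from the special fibre. The only
case which is not formal is that of transformations from the identity to `A ⊗_B A ⊗_A _`: their
value is a multiple of the Casimir element, which exists, and is central, over `A` already. -/
lemma exists_lift_generators (F : FrobeniusSystem B A)
    {T X : FGModuleCat.{u} A ⥤ FGModuleCat.{u} A} (hT : tensorGenerators.{u, u} B A T)
    (hX : tensorGenerators.{u, u} B A X) (β : S.res ⋙ T ⟶ S.res ⋙ X) :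
    ∃ α : T ⟶ X, Functor.whiskerLeft S.res α = β := by
  have hXa := tensorGenerators_additive hX
  obtain rfl | rfl := hT
  · obtain rfl | rfl := hX
    · obtain ⟨s, hs⟩ := S.elementHom_point_surjective ((β.app (regular.{u} D)).hom.hom S.point)
      exact ⟨idDesc (𝟭 _) s fun a => rfl, S.id_hom_ext hs⟩
    · obtain ⟨c, hc⟩ := S.exists_casimir_eq F β
      obtain ⟨c, rfl⟩ := S.elementHom_point_surjective c
      refine ⟨idDesc (bimodTensorFunctor.{u, u} B A) (F.casimir (M := FGModuleCat.of A A) c)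
        fun a => (F.map_casimir _ _).trans (F.smul_casimir a _).symm, S.id_hom_ext ?_⟩
      exact (F.map_casimir _ _).trans hc
  · obtain ⟨s, hs⟩ := tensorGenerators.map_surjective hX S.elementHom_point_surjective
      ((β.app (regular.{u} D)).hom.hom (tensorUnit.{u, u} B A _ S.point))
    exact ⟨tensorFunctorDesc X (tensorGenerators_commutesWithScalars hX) s,
      S.tensor_hom_ext ((tensorFunctorDesc_app_tensorUnit X
        (tensorGenerators_commutesWithScalars hX) s S.point).trans hs)⟩

/-- Restriction to the special fibre is full on 2-morphisms. -/
lemma exists_restrictMap_eq (F : FrobeniusSystem B A)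
    {X Y : FGModuleCat.{u} A ⥤ FGModuleCat.{u} A}
    (hX : additiveClosure (tensorGenerators.{u, u} B A) X)
    (hY : additiveClosure (tensorGenerators.{u, u} B A) Y)
    (β : (S.preservesEssImage hX).restrict ⟶ (S.preservesEssImage hY).restrict) :
    ∃ α : X ⟶ Y, restrictMap (S.preservesEssImage hX) (S.preservesEssImage hY) α = β := by
  let β' : S.res ⋙ X ⟶ S.res ⋙ Y := (S.preservesEssImage hX).restrictIso.inv ≫
    Functor.whiskerRight β S.res ≫ (S.preservesEssImage hY).restrictIso.hom
  suffices h : ∃ α : X ⟶ Y, Functor.whiskerLeft S.res α = β' by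
    obtain ⟨α, hα⟩ := h
    exact ⟨α, (restrictMap_eq_iff _ _ _ _).2 fun M => congrArg (fun t => t.app M) hα⟩
  obtain ⟨n, T, p, q, hT, hpq⟩ := hX.exists_sum
  obtain ⟨n', T', p', q', hT', hpq'⟩ := hY.exists_sum
  choose γ hγ using fun i j => S.exists_lift_generators F (hT i) (hT' j)
    (Functor.whiskerLeft S.res (q i) ≫ β' ≫ Functor.whiskerLeft S.res (p' j))
  refine ⟨∑ i, ∑ j, p i ≫ γ i j ≫ q' j, ?_⟩
  ext M : 2
  have h : ∀ i j, (γ i j).app (S.res.obj M) =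
      (q i).app (S.res.obj M) ≫ β'.app M ≫ (p' j).app (S.res.obj M) := fun i j =>
    congrArg (fun t => t.app M) (hγ i j)
  have h1 := congrArg (fun t => t.app (S.res.obj M)) hpq
  have h2 := congrArg (fun t => t.app (S.res.obj M)) hpq'
  simp only [NatTrans.app_sum, NatTrans.comp_app, NatTrans.id_app] at h1 h2
  calc (∑ i, ∑ j, p i ≫ γ i j ≫ q' j).app (S.res.obj M)
      = (∑ i, (p i).app (S.res.obj M) ≫ (q i).app (S.res.obj M)) ≫ β'.app M ≫
          ∑ j, (p' j).app (S.res.obj M) ≫ (q' j).app (S.res.obj M) := by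
        simp only [NatTrans.app_sum, NatTrans.comp_app, h, Preadditive.sum_comp,
          Preadditive.comp_sum, Category.assoc]
        exact Finset.sum_comm
    _ = β'.app M := by
        rw [h1, h2]
        simp

end SpecialFibre

/-! ### 2-morphisms vanishing on the special fibre are nilpotent -/

namespace SpecialFibre

open PreservesEssImage

variable {B : Type u} {A : Type u} {D : Type} [CommRing B] [CommRing A] [CommRing D]
    [Algebra B A] [Algebra ℂ B] [Algebra ℂ A] [Algebra ℂ D] (S : SpecialFibre B A D)

/-- The ideal of `A` generated by the maximal ideal of the closed point, written `𝔪` below. -/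
def ideal : Ideal A := (RingHom.ker S.χ).map (algebraMap B A)

lemma algebraMap_mem_ideal {b : B} (hb : S.χ b = 0) : algebraMap B A b ∈ S.ideal :=
  Ideal.mem_map_of_mem _ hb

lemma smul_mem_of_algebraMap_smul_mem {M : Type*} [AddCommGroup M] [Module A M]
    {p : AddSubgroup M}
    (h : ∀ b, S.χ b = 0 → ∀ m : M, algebraMap B A b • m ∈ p) {x : M}
    (hx : x ∈ S.ideal • (⊤ : Submodule A M)) : x ∈ p := by
  refine Submodule.smul_induction_on hx (fun a ha m _ => ?_) fun _ _ => add_mem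
  have ha' : a ∈ Submodule.span A (algebraMap B A '' RingHom.ker S.χ) := ha
  clear ha
  induction ha' using Submodule.span_induction generalizing m with
  | mem x hx =>
    obtain ⟨b, hb, rfl⟩ := hx
    exact h b hb m
  | zero => rw [zero_smul]; exact p.zero_mem
  | add x y _ _ hx hy => rw [add_smul]; exact p.add_mem (hx m trivial) (hy m trivial)
  | smul a x _ hx =>
    rw [smul_eq_mul, mul_comm, mul_smul]
    exact hx (a • m) trivial

/-- The largest quotient of `M` which is a module over the special fibre. -/
noncomputable abbrev reduce (M : FGModuleCat.{u} A) : FGModuleCat.{u} A :=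
  FGModuleCat.of A (M ⧸ (S.ideal • ⊤ : Submodule A M))

/-- The quotient map. -/
noncomputable def toReduce (M : FGModuleCat.{u} A) : M ⟶ S.reduce M :=
  homOfLinear (N := S.reduce M) (Submodule.mkQ _)

lemma toReduce_eq_zero_iff {M : FGModuleCat.{u} A} (m : M) :
    (S.toReduce M).hom.hom m = 0 ↔ m ∈ (S.ideal • ⊤ : Submodule A M) :=
  Submodule.Quotient.mk_eq_zero _

lemma annihilates_reduce (M : FGModuleCat.{u} A) : S.Annihilates (S.reduce M) := fun b hb m => by
  obtain ⟨m, rfl⟩ := Submodule.Quotient.mk_surjective _ m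
  exact (Submodule.Quotient.mk_eq_zero _).2
    (Submodule.smul_mem_smul (S.algebraMap_mem_ideal hb) trivial)

variable [Module.Finite B A]

/-- Tensoring is right exact: the reduction of `A ⊗_B A ⊗_A M` is tensored from that of `M`. -/
lemma mem_of_bimodTensorFunctor_map_eq_zero {M : FGModuleCat.{u} A}
    (x : (bimodTensorFunctor.{u, u} B A).obj M)
    (hx : ((bimodTensorFunctor.{u, u} B A).map (S.toReduce M)).hom.hom x = 0) :
    x ∈ (S.ideal • ⊤ : Submodule A ((bimodTensorFunctor.{u, u} B A).obj M)) := by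
  let N := (bimodTensorFunctor.{u, u} B A).obj M
  let g₀ : M →+ S.reduce N := (S.toReduce N).hom.hom.toAddMonoidHom.comp (tensorUnit.{u, u} B A M)
  have hg₀ : ∀ b (m : M), g₀ (algebraMap B A b • m) = algebraMap B A b • g₀ m := fun b m =>
    (congrArg (S.toReduce N).hom.hom (tensorUnit_algebraMap.{u, u} M b m)).trans
      (map_smul _ _ _)
  let g : S.reduce M →+ S.reduce N := QuotientAddGroup.lift
    (S.ideal • ⊤ : Submodule A M).toAddSubgroup g₀ fun m hm =>
      S.smul_mem_of_algebraMap_smul_mem (p := g₀.ker) (fun b hb m => by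
        rw [AddMonoidHom.mem_ker, hg₀]
        exact S.annihilates_reduce N b hb _) hm
  have hg : ∀ b (m : S.reduce M), g (algebraMap B A b • m) = algebraMap B A b • g m :=
    fun b m => by
      obtain ⟨m, rfl⟩ := Submodule.Quotient.mk_surjective _ m
      exact hg₀ b m
  have key : (bimodTensorFunctor.{u, u} B A).map (S.toReduce M) ≫ tensorDesc.{u, u} g hg =
      S.toReduce N := tensorUnit_hom_ext fun m => by
    exact tensorDesc_tensorUnit g hg _
  rw [← S.toReduce_eq_zero_iff (M := N), ← key]
  exact (congrArg (tensorDesc.{u, u} g hg).hom.hom hx).trans (map_zero _)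

lemma mem_of_generator_map_eq_zero {T : FGModuleCat.{u} A ⥤ FGModuleCat.{u} A}
    (hT : tensorGenerators.{u, u} B A T) {M : FGModuleCat.{u} A}
    (x : T.obj M) (hx : (T.map (S.toReduce M)).hom.hom x = 0) :
    x ∈ (S.ideal • ⊤ : Submodule A (T.obj M)) := by
  obtain rfl | rfl := hT
  · exact (S.toReduce_eq_zero_iff x).1 hx
  · exact S.mem_of_bimodTensorFunctor_map_eq_zero x hx

/-- For the functors under consideration, `X M` and `X (M ⧸ 𝔪 M)` agree modulo `𝔪`. -/
lemma mem_of_map_toReduce_eq_zero {X : FGModuleCat.{u} A ⥤ FGModuleCat.{u} A}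
    (hX : additiveClosure (tensorGenerators.{u, u} B A) X) {M : FGModuleCat.{u} A}
    (x : X.obj M) (hx : (X.map (S.toReduce M)).hom.hom x = 0) :
    x ∈ (S.ideal • ⊤ : Submodule A (X.obj M)) := by
  obtain ⟨n, T, p, q, hT, h⟩ := hX.exists_sum
  have h1 : ∑ i, ((q i).app M).hom.hom (((p i).app M).hom.hom x) = x := by
    let ev : (X.obj M ⟶ X.obj M) →+ X.obj M := AddMonoidHom.mk' (fun f => f.hom.hom x)
      fun _ _ => rfl
    have h2 := congrArg (fun t => ev (NatTrans.app t M)) h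
    simp only [NatTrans.app_sum, map_sum] at h2
    exact h2
  rw [← h1]
  refine Submodule.sum_mem _ fun i _ => ?_
  have h3 : ((T i).map (S.toReduce M)).hom.hom (((p i).app M).hom.hom x) = 0 := by
    have h4 := congrArg (fun t => t.hom.hom x) ((p i).naturality (S.toReduce M))
    refine h4.symm.trans ((congrArg ((p i).app _).hom.hom hx).trans (map_zero _))
  have h5 : ((p i).app M).hom.hom x ∈ (S.ideal • ⊤ : Submodule A ((T i).obj M)) := by
    exact S.mem_of_generator_map_eq_zero (hT i) _ h3
  have h6 := Submodule.mem_map_of_mem (f := ((q i).app M).hom.hom) h5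
  rw [Submodule.map_smul''] at h6
  exact Submodule.smul_mono le_rfl le_top h6

/-- A transformation which vanishes on the special fibre has its image in `𝔪 X M`, as seen by
naturality with respect to the projection of `M` to `M ⧸ 𝔪 M`. -/
lemma app_mem_of_vanishes {X : FGModuleCat.{u} A ⥤ FGModuleCat.{u} A}
    (hX : additiveClosure (tensorGenerators.{u, u} B A) X) {α : X ⟶ X}
    (hα : ∀ M, α.app (S.res.obj M) = 0) {M : FGModuleCat.{u} A} (x : X.obj M) :
    (α.app M).hom.hom x ∈ (S.ideal • ⊤ : Submodule A (X.obj M)) := by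
  refine S.mem_of_map_toReduce_eq_zero hX _ ?_
  obtain ⟨N, ⟨e⟩⟩ := (S.annihilates_reduce M).essImage
  have h0 : α.app (S.reduce M) = 0 := by
    rw [← cancel_epi (X.map e.hom), α.naturality, hα, comp_zero, zero_comp]
  have h1 := congrArg (fun t => t.hom.hom x) (α.naturality (S.toReduce M))
  rw [h0] at h1
  exact h1.symm

/-- If the maximal ideal of the closed point is nilpotent, then endomorphisms which vanish on the
special fibre are nilpotent. -/
lemma isNilpotent_of_vanishes (hS : IsNilpotent (RingHom.ker S.χ))
    {X : FGModuleCat.{u} A ⥤ FGModuleCat.{u} A}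
    (hX : additiveClosure (tensorGenerators.{u, u} B A) X) {α : End X}
    (hα : ∀ M, NatTrans.app (α : X ⟶ X) (S.res.obj M) = 0) : IsNilpotent α := by
  obtain ⟨n, hn⟩ := hS
  -- Since `α` is `A`-linear, its powers map `X M` into `𝔪 ^ k X M`.
  have key : ∀ k M (x : X.obj M), (NatTrans.app (α ^ k : End X) M).hom.hom x ∈
      (S.ideal ^ k • ⊤ : Submodule A (X.obj M)) := fun k => by
    induction k with
    | zero => intro M x; simp
    | succ k ih =>
      intro M x
      have h1 := Submodule.mem_map_of_mem (f := (NatTrans.app (α ^ k : End X) M).hom.hom)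
        (S.app_mem_of_vanishes hX hα x)
      rw [Submodule.map_smul''] at h1
      have h2 : Submodule.map (NatTrans.app (α ^ k : End X) M).hom.hom ⊤ ≤
          (S.ideal ^ k • ⊤ : Submodule A (X.obj M)) := by
        rintro _ ⟨y, -, rfl⟩
        exact ih M y
      have h3 := Submodule.smul_mono le_rfl h2 h1
      rw [← Submodule.mul_smul, ← pow_succ'] at h3
      rw [pow_succ]
      exact h3
  refine ⟨n, NatTrans.ext (funext fun M => FGModuleCat.hom_ext (LinearMap.ext fun x => ?_))⟩
  have h := key n M x
  rw [ideal, ← Ideal.map_pow, hn, Ideal.zero_eq_bot, Ideal.map_bot, Submodule.bot_smul] at h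
  exact h

end SpecialFibre

/-! ### Lifting 1-morphisms from the special fibre -/

section retracts

variable {C : Type u} [Category.{v} C] [Preadditive C] {P : ObjectProperty C}

lemma additiveClosure.of_retract [HasFiniteBiproducts C] {X Y : C} (hX : additiveClosure P X)
    (i : Y ⟶ X) (r : X ⟶ Y) (h : i ≫ r = 𝟙 Y) : additiveClosure P Y := by
  obtain ⟨n, T, p, q, hT, hpq⟩ := hX.exists_sum
  refine additiveClosure_of_sum T (fun j => i ≫ p j) (fun j => q j ≫ r) hT ?_
  have h1 := congrArg (fun t => i ≫ t ≫ r) hpq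
  simpa [Preadditive.sum_comp, Preadditive.comp_sum, h] using h1

lemma additiveClosure_biproduct [HasFiniteBiproducts C] {n : ℕ} (T : Fin n → C)
    (hT : ∀ i, P (T i)) : additiveClosure P (⨁ T) :=
  ⟨n, T, biproduct.bicone T, hT, ⟨biproduct.isBilimit T⟩, ⟨Retract.refl _⟩⟩

end retracts

namespace SpecialFibre

open PreservesEssImage

variable {B : Type u} {A : Type u} {D : Type} [CommRing B] [CommRing A] [CommRing D]
    [Algebra B A] [Algebra ℂ B] [Algebra ℂ A] [Algebra ℂ D] (S : SpecialFibre B A D)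
    [Module.Finite B A] [Module.Finite ℂ D]

/-- Restriction to the special fibre, as a ring homomorphism between endomorphism rings. -/
noncomputable def restrictEnd {X : FGModuleCat.{u} A ⥤ FGModuleCat.{u} A}
    (hX : PreservesEssImage S.res X) : End X →+* End hX.restrict where
  toFun α := restrictMap hX hX α
  map_one' := restrictMap_id hX
  map_mul' α β := restrictMap_comp hX hX hX β α
  map_zero' := by
    have := restrictMap_add hX hX (0 : X ⟶ X) 0
    rw [add_zero] at this
    exact left_eq_add.mp this
  map_add' α β := restrictMap_add hX hX α β

/-- Restriction to the special fibre is essentially surjective on 1-morphisms: idempotents lift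
along the surjection of endomorphism rings, whose kernel is nil. -/
lemma exists_restrict_iso_of_mem [IsNoetherianRing A] (F : FrobeniusSystem B A)
    (hS : IsNilpotent (RingHom.ker S.χ)) {Z : FGModuleCat.{u} D ⥤ FGModuleCat.{u} D}
    (hZ : additiveClosure (tensorGenerators.{0, u} ℂ D) Z) :
    ∃ (Y : FGModuleCat.{u} A ⥤ FGModuleCat.{u} A)
      (hY : additiveClosure (tensorGenerators.{u, u} B A) Y),
      Nonempty ((S.preservesEssImage hY).restrict ≅ Z) := by
  have := hasFiniteBiproducts_functor.{u} (A := A)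
  obtain ⟨n, T', p, q, hT', hpq⟩ := hZ.exists_sum
  choose T hT h e using fun i => S.exists_iso_restrict (B := B) (A := A) (hT' i)
  replace e := fun i => (e i).some
  have hX := additiveClosure_biproduct T hT
  let hX' := S.preservesEssImage hX
  let P : Z ⟶ hX'.restrict := ∑ i, p i ≫ (e i).inv ≫ restrictMap (h i) hX' (biproduct.ι T i)
  let Q : hX'.restrict ⟶ Z := ∑ i, restrictMap hX' (h i) (biproduct.π T i) ≫ (e i).hom ≫ q i
  have hPQ : P ≫ Q = 𝟙 Z := by
    rw [← hpq, Preadditive.sum_comp]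
    refine Finset.sum_congr rfl fun i _ => ?_
    rw [Preadditive.comp_sum, Finset.sum_eq_single i]
    · have h1 := restrictMap_comp (h i) hX' (h i) (biproduct.ι T i) (biproduct.π T i)
      rw [biproduct.ι_π_self, restrictMap_id] at h1
      simp [← reassoc_of% h1]
    · intro j _ hj
      have h1 := restrictMap_comp (h i) hX' (h j) (biproduct.ι T i) (biproduct.π T j)
      have h2 : restrictMap (h i) (h j) (0 : T i ⟶ T j) = 0 :=
        map_zero (AddMonoidHom.mk' (restrictMap (h i) (h j)) (restrictMap_add (h i) (h j)))
      rw [biproduct.ι_π_ne _ hj.symm, h2] at h1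
      simp [← reassoc_of% h1]
    · simp
  obtain ⟨e', he', he''⟩ := exists_isIdempotentElem_eq_of_ker_isNilpotent (S.restrictEnd hX')
    (fun α hα => S.isNilpotent_of_vanishes hS hX fun M => by
      have h1 := (restrictMap_eq_iff hX' hX' α 0).1 hα M
      rw [h1]
      simp)
    (Q ≫ P : End hX'.restrict) (S.exists_restrictMap_eq F hX hX (Q ≫ P))
    (by
      change (Q ≫ P) ≫ Q ≫ P = Q ≫ P
      rw [Category.assoc, reassoc_of% hPQ])
  obtain ⟨Y, i, r, hir, hri⟩ := IsIdempotentComplete.idempotents_split (⨁ T) e' he'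
  have hY := hX.of_retract i r hir
  let hY' := S.preservesEssImage hY
  have he3 : restrictMap hX' hX' e' = Q ≫ P := he''
  refine ⟨Y, hY, ⟨⟨restrictMap hY' hX' i ≫ Q, P ≫ restrictMap hX' hY' r, ?_, ?_⟩⟩⟩
  · rw [Category.assoc, ← Category.assoc Q, ← he3, ← restrictMap_comp, ← restrictMap_comp,
      ← hri, Category.assoc, hir, Category.comp_id, hir, restrictMap_id]
  · rw [Category.assoc, ← Category.assoc (restrictMap hX' hY' r), ← restrictMap_comp, hri, he3,
      Category.assoc, reassoc_of% hPQ, hPQ]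

end SpecialFibre

/-! ### 2-ideals without identities vanish on the special fibre -/

section contract

variable {B A : Type u} [CommRing B] [CommRing A] [Algebra B A] [Module.Finite B A]

lemma tensorUnit_formEval_algebraMap (φ : A →ₗ[B] B) (M : FGModuleCat.{u} A) (b : B)
    (x : (bimodTensorFunctor.{u, u} B A).obj M) :
    (tensorUnit.{u, u} B A M).comp (formEval φ M) (algebraMap B A b • x) =
      algebraMap B A b • (tensorUnit.{u, u} B A M).comp (formEval φ M) x := by
  have h := formEval_map φ (scalarEnd (algebraMap B A b) M) x
  rw [bimodTensorFunctor_commutesWithScalars] at h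
  exact (congrArg (tensorUnit.{u, u} B A M) h).trans (tensorUnit_algebraMap.{u, u} M b _)

/-- Contraction of the middle tensor factors of `(A ⊗_B A) ⊗_A (A ⊗_B A)` by a linear form. -/
noncomputable def tensorContract (φ : A →ₗ[B] B) :
    bimodTensorFunctor.{u, u} B A ⋙ bimodTensorFunctor.{u, u} B A ⟶
      bimodTensorFunctor.{u, u} B A where
  app M := tensorDesc.{u, u} (M := (bimodTensorFunctor.{u, u} B A).obj M)
    ((tensorUnit.{u, u} B A M).comp (formEval φ M)) (tensorUnit_formEval_algebraMap φ M)
  naturality M N f := tensorUnit_hom_ext fun x => by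
    refine (tensorDesc_tensorUnit _ (tensorUnit_formEval_algebraMap φ N) _).trans ?_
    refine Eq.trans ?_ (congrArg ((bimodTensorFunctor.{u, u} B A).map f).hom.hom
      (tensorDesc_tensorUnit _ (tensorUnit_formEval_algebraMap φ M) _)).symm
    exact congrArg (tensorUnit.{u, u} B A N) (formEval_map φ f x)

lemma tensorContract_app_tensorUnit (φ : A →ₗ[B] B) {M : FGModuleCat.{u} A}
    (x : (bimodTensorFunctor.{u, u} B A).obj M) :
    ((tensorContract φ).app M).hom.hom (tensorUnit.{u, u} B A _ x) =
      tensorUnit.{u, u} B A M (formEval φ M x) :=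
  tensorDesc_tensorUnit _ (tensorUnit_formEval_algebraMap φ M) _

/-- The element `1 ⊗ 1` of `A ⊗_B A`. -/
noncomputable def tensorOne (B A : Type u) [CommRing B] [CommRing A] [Algebra B A]
    [Module.Finite B A] : (bimodTensorFunctor.{u, u} B A).obj (FGModuleCat.of A A) :=
  tensorUnit.{u, u} B A (FGModuleCat.of A A) (1 : A)

/-- A morphism from `A ⊗_B A ⊗_A _` to a `B`-linear functor may take any value at `1 ⊗ 1`. -/
lemma exists_app_tensorOne_eq (X : FGModuleCat.{u} A ⥤ FGModuleCat.{u} A) [X.Additive]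
    (hX : CommutesWithScalars B X) (w : X.obj (FGModuleCat.of A A)) :
    ∃ P : bimodTensorFunctor.{u, u} B A ⟶ X,
      (P.app (FGModuleCat.of A A)).hom.hom (tensorOne B A) = w := by
  refine ⟨tensorFunctorDesc X hX w, ?_⟩
  rw [tensorOne, tensorFunctorDesc_app_tensorUnit]
  have h : elementHom (M := FGModuleCat.of A A) (1 : A) = 𝟙 _ :=
    FGModuleCat.hom_ext (LinearMap.ext fun a => mul_one a)
  rw [h, X.map_id]
  rfl

end contract

namespace SpecialFibre

variable {B : Type u} {A : Type u} {D : Type} [CommRing B] [CommRing A] [CommRing D]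
    [Algebra B A] [Algebra ℂ B] [Algebra ℂ A] [Algebra ℂ D] (S : SpecialFibre B A D)
    [Module.Finite B A]

omit [Module.Finite B A] in
/-- As the maximal ideal of the closed point is nilpotent, `B` is local. -/
lemma isUnit_of_χ_ne_zero {S : SpecialFibre B A D} (hS : IsNilpotent (RingHom.ker S.χ)) {b : B}
    (hb : S.χ b ≠ 0) : IsUnit b := by
  obtain ⟨n, hn⟩ := hS
  have h1 : IsNilpotent (b - algebraMap ℂ B (S.χ b)) := ⟨n, by
    have h2 : b - algebraMap ℂ B (S.χ b) ∈ RingHom.ker S.χ := by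
      rw [RingHom.mem_ker, map_sub, AlgHom.commutes]
      exact sub_self _
    have h3 := Ideal.pow_mem_pow h2 n
    rwa [hn] at h3⟩
  have h2 : IsUnit (algebraMap ℂ B (S.χ b)) := (isUnit_iff_ne_zero.2 hb).map _
  have h3 := h1.isUnit_add_left_of_commute h2 (Commute.all _ _)
  rwa [add_sub_cancel] at h3

/-- An element of `A` which does not vanish on the special fibre is sent to `1` by some `B`-linear
form. -/
lemma exists_form_eq_one [Module.Free B A] (hS : IsNilpotent (RingHom.ker S.χ)) {a : A}
    (ha : a ∉ S.ideal) : ∃ φ : A →ₗ[B] B, φ a = 1 := by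
  let e := Module.Free.chooseBasis B A
  have h1 : ∃ i, S.χ (e.repr a i) ≠ 0 := by
    by_contra! h
    refine ha ?_
    rw [← e.sum_repr a]
    refine Submodule.sum_mem _ fun i _ => ?_
    rw [Algebra.smul_def]
    exact Ideal.mul_mem_right _ _ (S.algebraMap_mem_ideal (h i))
  obtain ⟨i, hi⟩ := h1
  obtain ⟨b, hb⟩ := (isUnit_of_χ_ne_zero hS hi).exists_left_inv
  exact ⟨b • e.coord i, by simpa using hb⟩

/-- An element of `A ⊗_B A` which does not vanish on the special fibre is sent to an element of `A`
which does not vanish there by some `B`-linear form on the first factor. -/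
lemma exists_formEval_notMem [Module.Free B A]
    {s : (bimodTensorFunctor.{u, u} B A).obj (FGModuleCat.of A A)}
    (hs : s ∉ (S.ideal • ⊤ :
      Submodule A ((bimodTensorFunctor.{u, u} B A).obj (FGModuleCat.of A A)))) :
    ∃ ψ : A →ₗ[B] B, formEval ψ (FGModuleCat.of A A) s ∉ S.ideal := by
  let e := Module.Free.chooseBasis B A
  by_contra! h
  refine hs ?_
  rw [← sum_smul_tensorUnit_formEval e e.coord (fun a => by
    conv_rhs => rw [← e.sum_repr a]
    exact Finset.sum_congr rfl fun i _ => (Algebra.smul_def _ _).symm) s]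
  refine Submodule.sum_mem _ fun i _ => Submodule.smul_mem _ _ ?_
  have h1 := h (e.coord i)
  have h2 : (formEval (e.coord i) (FGModuleCat.of A A) s : A) ∈
      S.ideal • (⊤ : Submodule A A) := by
    rwa [smul_eq_mul, Ideal.mul_top]
  exact S.smul_mem_of_algebraMap_smul_mem
    (p := (Submodule.toAddSubgroup (S.ideal • ⊤ :
      Submodule A ((bimodTensorFunctor.{u, u} B A).obj (FGModuleCat.of A A)))).comap
      (tensorUnit.{u, u} B A (FGModuleCat.of A A)))
    (fun b hb m => by
      rw [AddSubgroup.mem_comap]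
      have h3 := tensorUnit_algebraMap.{u, u} (FGModuleCat.of A A) b m
      rw [h3]
      exact Submodule.smul_mem_smul (S.algebraMap_mem_ideal hb) Submodule.mem_top) h2

/-- If `s` does not vanish on the special fibre, then the element `1 ⊗ s ⊗ 1` of `F X F A`, with
`F = A ⊗_B A ⊗_A _`, is sent back to `1 ⊗ 1` by contracting with `B`-linear forms. -/
lemma exists_contraction [Module.Free B A] (hS : IsNilpotent (RingHom.ker S.χ))
    {X : FGModuleCat.{u} A ⥤ FGModuleCat.{u} A} (hX : tensorGenerators.{u, u} B A X)
    {s : X.obj (FGModuleCat.of A A)}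
    (hs : s ∉ (S.ideal • ⊤ : Submodule A (X.obj (FGModuleCat.of A A)))) :
    ∃ Q : bimodTensorFunctor.{u, u} B A ⋙ X ⋙ bimodTensorFunctor.{u, u} B A ⟶
        bimodTensorFunctor.{u, u} B A,
      (Q.app (FGModuleCat.of A A)).hom.hom (tensorUnit.{u, u} B A _
        ((X.map (elementHom (tensorOne B A))).hom.hom s)) = tensorOne B A := by
  have key : ∀ (φ : A →ₗ[B] B) (a : A), φ a = 1 →
      ((tensorContract φ).app (FGModuleCat.of A A)).hom.hom (tensorUnit.{u, u} B A _
        (a • tensorOne B A)) = tensorOne B A := fun φ a h => by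
    rw [tensorContract_app_tensorUnit, tensorOne, formEval_smul_tensorUnit, h, map_one, one_smul]
  obtain rfl | rfl := hX
  · have hs' : (s : A) ∉ S.ideal := by
      have h : s ∉ (S.ideal • ⊤ : Submodule A A) := hs
      rwa [smul_eq_mul, Ideal.mul_top] at h
    obtain ⟨φ, hφ⟩ := S.exists_form_eq_one hS hs'
    exact ⟨Functor.whiskerLeft _ (Functor.leftUnitor _).hom ≫ tensorContract φ, key φ s hφ⟩
  · obtain ⟨ψ, hψ⟩ := S.exists_formEval_notMem hs
    obtain ⟨φ, hφ⟩ := S.exists_form_eq_one hS hψ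
    refine ⟨Functor.whiskerLeft _ (tensorContract ψ) ≫ tensorContract φ, ?_⟩
    have h1 := tensorContract_app_tensorUnit ψ
      (((bimodTensorFunctor.{u, u} B A).map (elementHom (tensorOne B A))).hom.hom s)
    rw [formEval_map] at h1
    exact (congrArg ((tensorContract φ).app (FGModuleCat.of A A)).hom.hom h1).trans (key φ _ hφ)

/-- If a natural transformation `γ` between generating functors does not vanish on the special
fibre, then the identity of `F = A ⊗_B A ⊗_A _` factors through the horizontal composite `F γ F`. -/
lemma exists_comp_eq_id [Module.Free B A] (hS : IsNilpotent (RingHom.ker S.χ))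
    {T X : FGModuleCat.{u} A ⥤ FGModuleCat.{u} A} (hT : tensorGenerators.{u, u} B A T)
    (hX : tensorGenerators.{u, u} B A X) (γ : T ⟶ X)
    (hγ : Functor.whiskerLeft S.res γ ≠ 0) :
    ∃ (P : bimodTensorFunctor.{u, u} B A ⟶
        bimodTensorFunctor.{u, u} B A ⋙ T ⋙ bimodTensorFunctor.{u, u} B A)
      (Q : bimodTensorFunctor.{u, u} B A ⋙ X ⋙ bimodTensorFunctor.{u, u} B A ⟶
        bimodTensorFunctor.{u, u} B A),
      P ≫ Functor.whiskerLeft _ (Functor.whiskerRight γ _) ≫ Q = 𝟙 _ := by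
  -- `P` hits `1 ⊗ t ⊗ 1`, which `F γ F` sends to `1 ⊗ s ⊗ 1` with `s = γ t`; `Q` contracts `s`.
  obtain ⟨t, ht⟩ := hT.exists_generates
  have hT' := tensorGenerators_additive hT
  have hX' := tensorGenerators_additive hX
  let s := (γ.app (FGModuleCat.of A A)).hom.hom t
  have hs : s ∉ (S.ideal • ⊤ : Submodule A (X.obj (FGModuleCat.of A A))) := fun hs => by
    refine hγ (S.hom_ext_of_generates ht rfl ?_)
    have h1 := congrArg (fun φ => φ.hom.hom t) (γ.naturality (elementHom S.point))
    refine h1.trans ?_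
    refine S.smul_mem_of_algebraMap_smul_mem
      (p := (X.map (elementHom S.point)).hom.hom.toAddMonoidHom.ker) (fun b hb m => ?_) hs
    rw [AddMonoidHom.mem_ker]
    refine (map_smul (X.map (elementHom S.point)).hom.hom _ _).trans ?_
    exact (S.annihilates_res _).map (tensorGenerators_commutesWithScalars hX) b hb _
  obtain ⟨Q, hQ⟩ := S.exists_contraction hS hX hs
  have hFT : CommutesWithScalars B (bimodTensorFunctor.{u, u} B A ⋙ T ⋙
      bimodTensorFunctor.{u, u} B A) :=
    bimodTensorFunctor_commutesWithScalars.comp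
      ((tensorGenerators_commutesWithScalars hT).comp bimodTensorFunctor_commutesWithScalars)
  obtain ⟨P, hP⟩ : ∃ P : bimodTensorFunctor.{u, u} B A ⟶
      bimodTensorFunctor.{u, u} B A ⋙ T ⋙ bimodTensorFunctor.{u, u} B A,
      (P.app (FGModuleCat.of A A)).hom.hom (tensorOne B A) =
        tensorUnit.{u, u} B A _ ((T.map (elementHom (tensorOne B A))).hom.hom t) :=
    exists_app_tensorOne_eq (bimodTensorFunctor.{u, u} B A ⋙ T ⋙ bimodTensorFunctor.{u, u} B A)
      hFT _
  have h2 : (γ.app _).hom.hom ((T.map (elementHom (tensorOne B A))).hom.hom t) =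
      (X.map (elementHom (tensorOne B A))).hom.hom s :=
    congrArg (fun φ => φ.hom.hom t) (γ.naturality (elementHom (tensorOne B A)))
  refine ⟨P, Q, generates_tensor.natTrans_ext ?_⟩
  change (Q.app (FGModuleCat.of A A)).hom.hom (((bimodTensorFunctor.{u, u} B A).map
    (γ.app ((bimodTensorFunctor.{u, u} B A).obj (FGModuleCat.of A A)))).hom.hom
      ((P.app (FGModuleCat.of A A)).hom.hom (tensorOne B A))) = tensorOne B A
  rw [hP, map_tensorUnit, h2, hQ]

end SpecialFibre

/-! ### The maximal 2-ideal -/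

namespace SpecialFibre

open PreservesEssImage TensorTwoCat

variable {B : Type u} {A : Type u} {D : Type} [CommRing B] [CommRing A] [CommRing D]
    [Algebra B A] [Algebra ℂ B] [Algebra ℂ A] [Algebra ℂ D] (S : SpecialFibre B A D)
    [Module.Finite B A] [Module.Free B A] [Module.Finite ℂ A] [Module.Finite ℂ D]
    [Module.Free ℂ D]

lemma restriction_map₂_add {a b : TensorTwoCat.{u, u} B A} {X Y : a ⟶ b} (α β : X ⟶ Y) :
    S.restriction.map₂ (α + β) = S.restriction.map₂ α + S.restriction.map₂ β :=
  ObjectProperty.hom_ext _ (restrictMap_add _ _ (toNatTrans α) (toNatTrans β))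

lemma restriction_map₂_smul {a b : TensorTwoCat.{u, u} B A} {X Y : a ⟶ b} (r : ℂ) (α : X ⟶ Y) :
    S.restriction.map₂ (r • α) = r • S.restriction.map₂ α := by
  refine ext₂ fun M => S.res.map_injective ?_
  refine (map_restrictMap_app _ _ _ _).trans ?_
  refine Eq.trans ?_ (S.res_map_smul r ((toNatTrans (S.restriction.map₂ α)).app M)).symm
  refine Eq.trans ?_ (congrArg (r • ·) (map_restrictMap_app _ _ _ _)).symm
  change _ ≫ (r • (toNatTrans α).app (S.res.obj M)) ≫ _ = _
  rw [Linear.smul_comp, Linear.comp_smul]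

lemma restriction_map₂_eq_zero_iff {a b : TensorTwoCat.{u, u} B A} {X Y : a ⟶ b} (α : X ⟶ Y) :
    S.restriction.map₂ α = 0 ↔ ∀ M, (toNatTrans α).app (S.res.obj M) = 0 := by
  have hX := S.preservesEssImage X.property
  have hY := S.preservesEssImage Y.property
  have h1 : S.restriction.map₂ α = 0 ↔ restrictMap hX hY (toNatTrans α) = 0 :=
    ⟨fun h => congrArg toNatTrans h, fun h => ObjectProperty.hom_ext _ h⟩
  rw [h1, restrictMap_eq_iff]
  simp

/-- The 2-ideal of all 2-morphisms which vanish on modules over the special fibre. -/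
noncomputable def vanishingIdeal : TwoIdeal ℂ (TensorTwoCat.{u, u} B A) :=
  TwoIdeal.ker S.restriction S.restriction_map₂_add S.restriction_map₂_smul

lemma mem_vanishingIdeal_iff {a b : TensorTwoCat.{u, u} B A} {X Y : a ⟶ b} (α : X ⟶ Y) :
    α ∈ S.vanishingIdeal.carrier X Y ↔ ∀ M, (toNatTrans α).app (S.res.obj M) = 0 :=
  S.restriction_map₂_eq_zero_iff α

/-- An identity which vanishes on the special fibre is nilpotent, hence zero. -/
lemma vanishingIdeal_containsNoIdentity (hS : IsNilpotent (RingHom.ker S.χ)) :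
    S.vanishingIdeal.ContainsNoIdentity := fun a b X hX h => by
  obtain ⟨n, hn⟩ := S.isNilpotent_of_vanishes hS X.property
    (α := (1 : End X.obj)) ((S.mem_vanishingIdeal_iff _).1 h)
  rw [one_pow] at hn
  exact hX ((IsZero.iff_id_eq_zero X).2 (ObjectProperty.hom_ext _ hn))

/-- A generating functor, as a 1-morphism. -/
def generator [IsNoetherianRing A] {T : FGModuleCat.{u} A ⥤ FGModuleCat.{u} A}
    (hT : tensorGenerators.{u, u} B A T) (a b : TensorTwoCat.{u, u} B A) : a ⟶ b :=
  ⟨T, haveI := hasFiniteBiproducts_functor.{u} (A := A); additiveClosure_of_mem hT⟩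

/-- A 2-ideal with a 2-morphism which does not vanish on the special fibre contains the identity of
`A ⊗_B A ⊗_A _`. -/
lemma le_vanishingIdeal [Nontrivial A] (hS : IsNilpotent (RingHom.ker S.χ))
    {I : TwoIdeal ℂ (TensorTwoCat.{u, u} B A)} (hI : I.ContainsNoIdentity) :
    I ≤ S.vanishingIdeal := fun a b X Y α hα => by
  have := IsNoetherianRing.of_finite ℂ A
  rw [mem_vanishingIdeal_iff]
  obtain ⟨n, T, p, q, hT, hpq⟩ := X.property.exists_sum
  obtain ⟨n', T', p', q', hT', hpq'⟩ := Y.property.exists_sum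
  -- It suffices to treat the matrix entries of `α` with respect to the generating functors.
  suffices h : ∀ i j, Functor.whiskerLeft S.res (q i ≫ toNatTrans α ≫ p' j) = 0 by
    intro M
    have h1 := congrArg (fun t => t.app (S.res.obj M)) hpq
    have h2 := congrArg (fun t => t.app (S.res.obj M)) hpq'
    simp only [NatTrans.app_sum, NatTrans.comp_app, NatTrans.id_app] at h1 h2
    calc (toNatTrans α).app (S.res.obj M)
        = (∑ i, (p i).app (S.res.obj M) ≫ (q i).app (S.res.obj M)) ≫
            (toNatTrans α).app (S.res.obj M) ≫
            ∑ j, (p' j).app (S.res.obj M) ≫ (q' j).app (S.res.obj M) := by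
          rw [h1, h2]
          simp
      _ = ∑ i, ∑ j, (p i).app (S.res.obj M) ≫
            (Functor.whiskerLeft S.res (q i ≫ toNatTrans α ≫ p' j)).app M ≫
              (q' j).app (S.res.obj M) := by
          simp only [Preadditive.sum_comp, Preadditive.comp_sum, Category.assoc,
            Functor.whiskerLeft_app, NatTrans.comp_app]
          exact Finset.sum_comm
      _ = 0 := by simp [h]
  intro i j
  by_contra hγ
  obtain ⟨P, Q, hPQ⟩ := S.exists_comp_eq_id hS (hT i) (hT' j) _ hγ
  let T₁ : a ⟶ b := generator (hT i) a b
  let T₂ : a ⟶ b := generator (hT' j) a b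
  let F₁ : b ⟶ a := generator (B := B) (A := A) (Or.inr rfl) b a
  let γ : T₁ ⟶ T₂ := (ofNatTrans (X := T₁) (Y := X) (q i)) ≫ α ≫
    ofNatTrans (X := Y) (Y := T₂) (p' j)
  have hγI : γ ∈ I.carrier T₁ T₂ := I.comp_mem_left _ (I.comp_mem_right _ hα)
  let P₁ : F₁ ⟶ F₁ ≫ T₁ ≫ F₁ := ofNatTrans P
  let Q₁ : F₁ ≫ T₂ ≫ F₁ ⟶ F₁ := ofNatTrans Q
  have h1 : P₁ ≫ F₁ ◁ (γ ▷ F₁) ≫ Q₁ = 𝟙 F₁ := ObjectProperty.hom_ext _ hPQ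
  refine hI F₁ (fun h0 => ?_) (h1 ▸ I.comp_mem_left _ (I.comp_mem_right _
    (I.whiskerLeft_mem _ (I.whiskerRight_mem _ hγI))))
  -- The functor `A ⊗_B A ⊗_A _` is not zero, since multiplication sends `1 ⊗ 1` to `1`.
  have h2 : 𝟙 (bimodTensorFunctor.{u, u} B A) = 0 :=
    congrArg toNatTrans ((IsZero.iff_id_eq_zero _).1 h0)
  have h3 : tensorOne B A = 0 :=
    congrArg (fun t : bimodTensorFunctor.{u, u} B A ⟶ bimodTensorFunctor.{u, u} B A =>
      (t.app (FGModuleCat.of A A)).hom.hom (tensorOne B A)) h2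
  let N := FGModuleCat.of A A
  let g : N →+ N := AddMonoidHom.id A
  have hg : ∀ (b : B) (n : N), g (algebraMap B A b • n) = algebraMap B A b • g n := fun _ _ => rfl
  have h4 := tensorDesc_tensorUnit.{u, u} (B := B) (M := N) (N := N) g hg (1 : A)
  refine one_ne_zero (α := A) (h4.symm.trans ?_)
  exact (congrArg (tensorDesc.{u, u} (B := B) (M := N) (N := N) g hg).hom.hom h3).trans (map_zero _)

/-- The quotient of the 2-category of `B → A` by the largest 2-ideal without identities is the
2-category of the special fibre. -/
theorem exists_twoIdeal [IsScalarTower ℂ B A] [Nontrivial A] (F : FrobeniusSystem B A)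
    (hS : IsNilpotent (RingHom.ker S.χ)) :
    ∃ J : TwoIdeal ℂ (TensorTwoCat.{u, u} B A),
      (∀ I : TwoIdeal ℂ (TensorTwoCat.{u, u} B A),
        Maximal TwoIdeal.ContainsNoIdentity I ↔ I = J) ∧
      ∃ Φ : Pseudofunctor J.Quotient (TensorTwoCat.{0, u} ℂ D), IsLinearBiequivalence ℂ Φ := by
  have := IsNoetherianRing.of_finite ℂ A
  refine ⟨S.vanishingIdeal, fun I => ⟨fun hI => ?_, ?_⟩, _,
    isLinearBiequivalence_desc_ker S.restriction S.restriction_map₂_add S.restriction_map₂_smul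
      (fun {a b X Y} β => ?_) (fun {a b} Z => ?_) (fun c => ?_)⟩
  · exact le_antisymm (S.le_vanishingIdeal hS hI.prop)
      (hI.le_of_ge (S.vanishingIdeal_containsNoIdentity hS) (S.le_vanishingIdeal hS hI.prop))
  · rintro rfl
    exact ⟨S.vanishingIdeal_containsNoIdentity hS, fun I hI _ => S.le_vanishingIdeal hS hI⟩
  · obtain ⟨α, hα⟩ := S.exists_restrictMap_eq F X.property Y.property (toNatTrans β)
    exact ⟨ofNatTrans α, ObjectProperty.hom_ext _ hα⟩
  · obtain ⟨Y, hY, ⟨e⟩⟩ := S.exists_restrict_iso_of_mem F hS Z.property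
    exact ⟨⟨Y, hY⟩, ⟨ofNatIso e⟩⟩
  · exact ⟨⟨⟩, ⟨Bicategory.Equivalence.id _⟩⟩

end SpecialFibre

/-! ### Frobenius algebras and Frobenius systems -/

/-- Over a Frobenius algebra, every linear form is represented by an element. -/
lemma IsFrobeniusAlgebra.exists_represents {k R : Type*} [Field k] [CommRing R] [Algebra k R]
    [Module.Finite k R] {lam : R →ₗ[k] k} (h : ∀ x, (∀ y, lam (x * y) = 0) → x = 0)
    (μ : R →ₗ[k] k) : ∃ r, ∀ y, lam (r * y) = μ y := by
  let T : R →ₗ[k] Module.Dual k R := (LinearMap.mul k R).compr₂ lam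
  have hT : Function.Injective T := by
    rw [injective_iff_map_eq_zero]
    exact fun x hx => h x fun y => LinearMap.congr_fun hx y
  obtain ⟨r, hr⟩ := (LinearMap.injective_iff_surjective_of_finrank_eq_finrank
    (Subspace.dual_finrank_eq (K := k) (V := R)).symm).1 hT μ
  exact ⟨r, fun y => LinearMap.congr_fun hr y⟩

/-- If `A` and `B` are Frobenius algebras with forms `λ_A` and `λ_B`, and `A` is free over `B`, then
the `B`-linear form on `A` through which `λ_A` factors over `λ_B` generates `Hom_B(A, B)`; a basis
of `A` and the elements representing its coordinate functions form a Frobenius system. -/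
theorem IsFrobeniusAlgebra.nonempty_frobeniusSystem {B A : Type u} [CommRing B] [CommRing A]
    [Algebra B A] [Algebra ℂ B] [Algebra ℂ A] [IsScalarTower ℂ B A] [Module.Finite ℂ B]
    [Module.Finite ℂ A] [Nontrivial B] [Module.Free B A] [Module.Finite B A]
    (hA : IsFrobeniusAlgebra ℂ A) (hB : IsFrobeniusAlgebra ℂ B) :
    Nonempty (FrobeniusSystem B A) := by
  obtain ⟨lA, hA, -⟩ := hA
  obtain ⟨lB, hB, -⟩ := hB
  have ext_B : ∀ x y : B, (∀ b, lB (x * b) = lB (y * b)) → x = y := fun x y h =>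
    sub_eq_zero.1 (hB _ fun b => by rw [sub_mul, map_sub, h, sub_self])
  choose form hform using fun a : A => IsFrobeniusAlgebra.exists_represents hB
    (lA ∘ₗ LinearMap.mul ℂ A a ∘ₗ (IsScalarTower.toAlgHom ℂ B A).toLinearMap)
  replace hform : ∀ a b, lB (form a * b) = lA (a * algebraMap B A b) := hform
  let φ : A →ₗ[B] B :=
    { toFun := form
      map_add' := fun x y => ext_B _ _ fun b => by
        rw [add_mul, map_add, hform, hform, hform, add_mul, map_add]
      map_smul' := fun c x => ext_B _ _ fun b => by
        rw [RingHom.id_apply, smul_eq_mul, mul_assoc, mul_left_comm, hform, hform, Algebra.smul_def,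
          map_mul (algebraMap B A)]
        congr 1
        ring }
  have hφ : ∀ a b, lB (φ a * b) = lA (a * algebraMap B A b) := hform
  have φ_nondegenerate : ∀ a, (∀ x, φ (a * x) = 0) → a = 0 := fun a h => hA a fun y => by
    have := hφ (a * y) 1
    rwa [h, zero_mul, map_zero, map_one, mul_one, eq_comm] at this
  have φ_represents : ∀ ψ : A →ₗ[B] B, ∃ f, ∀ a, φ (f * a) = ψ a := fun ψ => by
    obtain ⟨f, hf⟩ := IsFrobeniusAlgebra.exists_represents hA (lB ∘ₗ ψ.restrictScalars ℂ)
    refine ⟨f, fun a => ext_B _ _ fun b => ?_⟩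
    have : lA (f * (b • a)) = lB (ψ (b • a)) := hf _
    rw [hφ, mul_assoc, mul_comm a, ← Algebra.smul_def, this, map_smul, smul_eq_mul, mul_comm]
  let e := Module.finBasis B A
  choose f hf using fun i => φ_represents (e.coord i)
  have sum_e : ∀ a, ∑ i, algebraMap B A (φ (f i * a)) * e i = a := fun a => by
    simp only [hf, ← Algebra.smul_def]
    exact e.sum_repr a
  refine ⟨⟨φ, _, e, f, sum_e, fun a => ?_⟩⟩
  refine sub_eq_zero.1 (φ_nondegenerate _ fun x => ?_)
  have h1 : φ ((∑ i, algebraMap B A (φ (a * e i)) * f i) * x) =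
      ∑ i, φ (a * e i) * φ (f i * x) := by
    simp only [Finset.sum_mul, map_sum, ← Algebra.smul_def, smul_mul_assoc, map_smul, smul_eq_mul]
  have h2 : φ (a * ∑ i, algebraMap B A (φ (f i * x)) * e i) = ∑ i, φ (a * e i) * φ (f i * x) := by
    simp only [Finset.mul_sum, map_sum, ← Algebra.smul_def, mul_smul_comm, map_smul, smul_eq_mul]
    exact Finset.sum_congr rfl fun i _ => mul_comm _ _
  rw [sub_mul, map_sub, h1, ← h2, sum_e, sub_self]

/-! ### The special fibre of an extension of rank two -/

/-- A finite-dimensional commutative local `ℂ`-algebra has a character whose kernel is nil. -/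
lemma exists_character (A : Type u) [CommRing A] [Algebra ℂ A] [Module.Finite ℂ A]
    [IsLocalRing A] : ∃ ρ : A →ₐ[ℂ] ℂ, ∀ a, ρ a = 0 → IsNilpotent a := by
  have := IsArtinianRing.of_finite ℂ A
  let K := IsLocalRing.ResidueField A
  have : Module.Finite ℂ K :=
    Module.Finite.of_surjective (Ideal.Quotient.mkₐ ℂ (IsLocalRing.maximalIdeal A)).toLinearMap
      Ideal.Quotient.mk_surjective
  let e : ℂ ≃ₐ[ℂ] K := AlgEquiv.ofBijective (Algebra.ofId ℂ K)
    IsAlgClosed.algebraMap_bijective_of_isIntegral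
  refine ⟨e.symm.toAlgHom.comp (Ideal.Quotient.mkₐ ℂ (IsLocalRing.maximalIdeal A)), fun a ha => ?_⟩
  have h1 : Ideal.Quotient.mk (IsLocalRing.maximalIdeal A) a = 0 :=
    e.symm.injective (ha.trans (map_zero _).symm)
  rw [Ideal.Quotient.eq_zero_iff_mem, ← IsLocalRing.jacobson_eq_maximalIdeal ⊥ bot_ne_top] at h1
  obtain ⟨n, hn⟩ := IsArtinianRing.isNilpotent_jacobson_bot (R := A)
  exact ⟨n, by simpa [hn] using Ideal.pow_mem_pow h1 n⟩

/-- A two-dimensional commutative `ℂ`-algebra with a character whose kernel is nil is the algebra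
of dual numbers. -/
lemma nonempty_dualNumber_algEquiv {Q : Type*} [CommRing Q] [Algebra ℂ Q]
    (hQ : Module.finrank ℂ Q = 2) (ρ : Q →ₐ[ℂ] ℂ) (hρ : ∀ q, ρ q = 0 → IsNilpotent q) :
    Nonempty (DualNumber ℂ ≃ₐ[ℂ] Q) := by
  have : Module.Finite ℂ Q := Module.finite_of_finrank_eq_succ hQ
  have hsurj : Function.Surjective ρ := fun z => ⟨algebraMap ℂ Q z, ρ.commutes z⟩
  have h1 : Module.finrank ℂ (LinearMap.ker ρ.toLinearMap) = 1 := by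
    have h2 := LinearMap.finrank_range_add_finrank_ker ρ.toLinearMap
    rw [LinearMap.range_eq_top.2 hsurj, finrank_top, Module.finrank_self, hQ] at h2
    omega
  obtain ⟨⟨x, hx⟩, hx0, hspan⟩ := finrank_eq_one_iff'.1 h1
  replace hx : ρ x = 0 := hx
  replace hx0 : x ≠ 0 := fun h => hx0 (Subtype.ext h)
  obtain ⟨c, hc⟩ := hspan ⟨x * x, by simp [hx]⟩
  replace hc : c • x = x * x := congrArg Subtype.val hc
  -- `x ^ 2 = c x` gives `x ^ (n + 1) = c ^ n x`, so nilpotency of `x` forces `c = 0`.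
  have hpow : ∀ n : ℕ, x ^ (n + 1) = c ^ n • x := fun n => by
    induction n with
    | zero => simp
    | succ n ih => rw [pow_succ, ih, smul_mul_assoc, ← hc, smul_smul, ← pow_succ]
  obtain ⟨n, hn⟩ := hρ x hx
  have hc0 : c = 0 := by
    have h2 := hpow n
    rw [pow_succ, hn, zero_mul, eq_comm, smul_eq_zero] at h2
    exact eq_zero_of_pow_eq_zero (h2.resolve_right hx0)
  have hxx : x * x = 0 := by rw [← hc, hc0, zero_smul]
  let g : DualNumber ℂ →ₐ[ℂ] Q :=
    DualNumber.lift ⟨(Algebra.ofId ℂ Q, x), hxx, fun a => Commute.all _ _⟩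
  have hg : ∀ d, g d = algebraMap ℂ Q d.fst + d.snd • x := fun d => by
    rw [Algebra.smul_def]
    exact DualNumber.lift_apply_apply _ _
  have hinj : Function.Injective g := by
    rw [injective_iff_map_eq_zero]
    intro d hd
    rw [hg] at hd
    have h3 := congrArg ρ hd
    rw [map_add, map_smul, hx, smul_zero, add_zero, AlgHom.commutes, map_zero] at h3
    replace h3 : d.fst = 0 := h3
    rw [h3, map_zero, zero_add, smul_eq_zero] at hd
    exact TrivSqZeroExt.ext h3 (hd.resolve_right hx0)
  have hdim : Module.finrank ℂ (DualNumber ℂ) = Module.finrank ℂ Q := by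
    rw [hQ]
    exact (Module.finrank_prod (R := ℂ) (M := ℂ) (M' := ℂ)).trans (by simp)
  exact ⟨AlgEquiv.ofBijective g ⟨hinj, (LinearMap.injective_iff_surjective_of_finrank_eq_finrank
    (f := g.toLinearMap) hdim).1 hinj⟩⟩

/-- The fibre `A ⧸ ker χ A` of a free extension `B → A` at a character `χ` of `B` has dimension the
rank of `A`. -/
lemma finrank_quotient_map_ker {B A : Type u} [CommRing B] [CommRing A] [Algebra B A]
    [Algebra ℂ B] [Algebra ℂ A] [IsScalarTower ℂ B A] [Module.Finite ℂ A] [Nontrivial B]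
    [Module.Free B A] [Module.Finite B A] (χ : B →ₐ[ℂ] ℂ) :
    Module.finrank ℂ (A ⧸ (RingHom.ker χ).map (algebraMap B A)) = Module.finrank B A := by
  let e := Module.finBasis B A
  let I := (RingHom.ker χ).map (algebraMap B A)
  let φ : A →ₗ[ℂ] Fin (Module.finrank B A) → ℂ :=
    LinearMap.pi fun i => χ.toLinearMap ∘ₗ (e.coord i).restrictScalars ℂ
  have hφ : ∀ a i, φ a i = χ (e.repr a i) := fun _ _ => rfl
  have hsurj : Function.Surjective φ := fun z => by
    refine ⟨∑ i, algebraMap ℂ B (z i) • e i, funext fun i => ?_⟩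
    rw [hφ, e.repr_sum_self, AlgHom.commutes]
    rfl
  have hker : ∀ a, φ a = 0 ↔ a ∈ I := fun a => by
    constructor
    · intro h
      rw [← e.sum_repr a]
      refine Ideal.sum_mem _ fun i _ => ?_
      rw [Algebra.smul_def]
      exact Ideal.mul_mem_right _ _ (Ideal.mem_map_of_mem _ (congrFun h i))
    · intro h
      induction h using Submodule.span_induction with
      | mem x hx =>
        obtain ⟨b, hb, rfl⟩ := hx
        funext i
        rw [hφ, Algebra.algebraMap_eq_smul_one, map_smul, Finsupp.smul_apply, smul_eq_mul, map_mul,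
          show χ b = 0 from hb, zero_mul]
        rfl
      | zero => exact map_zero φ
      | add x y _ _ hx hy => rw [map_add, hx, hy, add_zero]
      | smul a x _ hx =>
        have h1 : a * x = ∑ i, e.repr x i • (a * e i) := by
          conv_lhs => rw [← e.sum_repr x]
          simp only [Finset.mul_sum, mul_smul_comm]
        funext j
        rw [hφ, smul_eq_mul, h1, map_sum, Finsupp.finsetSum_apply, map_sum]
        refine Finset.sum_eq_zero fun i _ => ?_
        rw [map_smul, Finsupp.smul_apply, smul_eq_mul, map_mul, ← hφ, hx, Pi.zero_apply, zero_mul]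
  let mk : A →ₗ[ℂ] A ⧸ I := (Ideal.Quotient.mkₐ ℂ I).toLinearMap
  have hmk : Function.Surjective mk := Ideal.Quotient.mk_surjective
  have hkk : LinearMap.ker mk = LinearMap.ker φ := by
    ext a
    exact Ideal.Quotient.eq_zero_iff_mem.trans (hker a).symm
  have h1 := LinearMap.finrank_range_add_finrank_ker mk
  have h2 := LinearMap.finrank_range_add_finrank_ker φ
  rw [LinearMap.range_eq_top.2 hmk, finrank_top, hkk] at h1
  rw [LinearMap.range_eq_top.2 hsurj, finrank_top, Module.finrank_fin_fun] at h2
  exact Nat.add_right_cancel (h1.trans h2.symm)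

/-- A free extension of rank two of a subalgebra of a local algebra has special fibre the algebra
of dual numbers, taken at the residue field of the subalgebra. -/
theorem exists_specialFibre_dualNumber {B A : Type u} [CommRing B] [CommRing A] [Algebra B A]
    [Algebra ℂ B] [Algebra ℂ A] [IsScalarTower ℂ B A] [Module.Finite ℂ B] [Module.Finite ℂ A]
    [IsLocalRing A] [Module.Free B A] [Module.Finite B A] [FaithfulSMul B A]
    (hrank : Module.finrank B A = 2) :
    ∃ S : SpecialFibre B A (DualNumber ℂ), IsNilpotent (RingHom.ker S.χ) := by
  have : Nontrivial B := (algebraMap B A).domain_nontrivial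
  obtain ⟨ρ, hρ⟩ := exists_character A
  let χ : B →ₐ[ℂ] ℂ := ρ.comp (IsScalarTower.toAlgHom ℂ B A)
  let I := (RingHom.ker χ).map (algebraMap B A)
  have hI : ∀ a ∈ I, ρ a = 0 := fun a ha =>
    (Ideal.map_le_iff_le_comap.2 (fun b hb => hb) : I ≤ RingHom.ker ρ) ha
  obtain ⟨e⟩ := nonempty_dualNumber_algEquiv ((finrank_quotient_map_ker χ).trans hrank)
    (Ideal.Quotient.liftₐ I ρ hI) fun q hq => by
      obtain ⟨a, rfl⟩ := Ideal.Quotient.mk_surjective q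
      exact (hρ a hq).map _
  refine ⟨⟨χ, e.symm.toAlgHom.comp (Ideal.Quotient.mkₐ ℂ I), ?_, fun b => ?_, fun a ha => ?_⟩, ?_⟩
  · exact e.symm.surjective.comp Ideal.Quotient.mk_surjective
  · rw [← sub_eq_zero]
    have h1 : algebraMap B A b - algebraMap ℂ A (χ b) ∈ I := by
      rw [IsScalarTower.algebraMap_apply ℂ B A, ← map_sub]
      refine Ideal.mem_map_of_mem _ ?_
      rw [RingHom.mem_ker, map_sub, AlgHom.commutes]
      exact sub_self _
    have h2 := congrArg e.symm (Ideal.Quotient.eq_zero_iff_mem.2 h1)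
    rw [map_zero, map_sub, map_sub] at h2
    refine Eq.trans ?_ h2
    congr 1
    exact (AlgHom.commutes (e.symm.toAlgHom.comp (Ideal.Quotient.mkₐ ℂ I)) _).symm
  · exact Ideal.Quotient.eq_zero_iff_mem.1 (e.symm.injective (ha.trans (map_zero e.symm).symm))
  · have := IsNoetherianRing.of_finite ℂ B
    rw [Ideal.FG.isNilpotent_iff_le_nilradical (IsNoetherian.noetherian _)]
    intro b hb
    exact (IsNilpotent.map_iff (FaithfulSMul.algebraMap_injective B A)).1 (hρ _ hb)

theorem proposition3p2 {A : Type u} [CommRing A] [Algebra ℂ A] [Module.Finite ℂ A] [IsLocalRing A]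
    (B : Subalgebra ℂ A) [Module.Free B A] [Module.Finite B A]
    (hA : IsFrobeniusAlgebra ℂ A) (hB : IsFrobeniusAlgebra ℂ B)
    (hrank : Module.finrank B A = 2) :
    ∃ J : TwoIdeal ℂ (TensorTwoCat.{u, u, u} B A),
      (∀ I : TwoIdeal ℂ (TensorTwoCat.{u, u, u} B A),
        Maximal TwoIdeal.ContainsNoIdentity I ↔ I = J) ∧
      ∃ Φ : Pseudofunctor J.Quotient DualNumberTwoCat.{u}, IsLinearBiequivalence ℂ Φ := by
  obtain ⟨F⟩ := IsFrobeniusAlgebra.nonempty_frobeniusSystem hA hB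
  obtain ⟨S, hS⟩ := exists_specialFibre_dualNumber (B := B) hrank
  exact S.exists_twoIdeal F hS
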